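/- **Theorem 1.3 (Hopf Lemma).** Let $n\ge 2$ and let $\mathcal S^{n\times n}$ be the space of real symmetric $n\times n$ matrices. Let $\Omega\subset\mathbb R^n$ be open and connected, $\hat x\in\partial\Omega$, with $\partial\Omega$ of class $C^2$ near $\hat x$, and let $\nu$ be the interior unit normal of $\partial\Omega$ at $\hat x$; that is, for some open neighbourhood $N$ of $\hat x$ and some $\rho\in C^2(N)$ with nowhere vanishing gradient, $\Omega\cap N=\{\rho>0\}$, $\partial\Omega\cap N=\{\rho=0\}$, and $\nu=\nabla\rho(\hat x)/|\nabla\rho(\hat x)|$. Let $U\subset\mathcal S^{n\times n}$ be open with $$0\in\partial U,\qquad U+\mathcal P\subset U,\qquad tU\subset U\quad\text{for all } t>0,$$ where $\mathcal P$ is the set of non-negative (positive semidefinite) symmetric matrices, and suppose that there is $\mu>0$ such that $U+C_\mu(\nu)\subset U$, where $$C_\mu(\nu)=\{t(\nu\otimes\nu+A):A\in\mathcal S^{n\times n},\ \|A\|<\mu,\ t>0\}.$$ Let $F[\varphi]=\nabla^2\varphi+L(\cdot,\nabla\varphi)$, where $L:(\Omega\cup\{\hat x\})\times\mathbb R^n\to\mathcal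 S^{n\times n}$ is locally Lipschitz. Let $u,v:\Omega\cup\{\hat x\}\to\mathbb R$ be locally Lipschitz and satisfy $F[u]\in\mathcal S^{n\times n}\setminus U$ and $F[v]\in\overline U$ in $\Omega$ in the viscosity sense: for every $x_0\in\Omega$ and every $\varphi\in C^2(\Omega)$, - if $\varphi(x_0)=u(x_0)$ and $\varphi\le u$ near $x_0$, then $F[\varphi](x_0)\notin U$; - if $\varphi(x_0)=v(x_0)$ and $\varphi\ge v$ near $x_0$, then $F[\varphi](x_0)\in\overline U$. Assume that $u>v$ in $\Omega$ and $u(\hat x)=v(\hat x)$. Then $$\liminf_{s\to0^+}\frac{(u-v)(\hat x+s\nu)}{s}>0.$$ -/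

import Mathlib

open Set Filter Topology
open scoped Matrix.Norms.L2Operator

/-- Euclidean `n`-space. -/
abbrev Euc (n : ℕ) : Type := EuclideanSpace ℝ (Fin n)

/-- The space of real symmetric `n × n` matrices, with the topology and the (operator) norm
inherited from the space of all matrices. -/
def symMat (n : ℕ) : Submodule ℝ (Matrix (Fin n) (Fin n) ℝ) where
  carrier := {A | A.IsSymm}
  add_mem' := fun ha hb => Matrix.IsSymm.add ha hb
  zero_mem' := Matrix.isSymm_zero
  smul_mem' := fun c _ ha => Matrix.IsSymm.smul ha c

/-- The rank-one symmetric matrix `ν ⊗ ν`, with entries `νᵢ νⱼ`. -/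
def tensorSq {n : ℕ} (ν : Euc n) : symMat n :=
  ⟨Matrix.of fun i j => ν i * ν j, by
    apply Matrix.IsSymm.ext
    intro i j
    simp [mul_comm]⟩

/-- The matrix of second partial derivatives of `φ` at `x`. -/
noncomputable def hessianMatrix {n : ℕ} (φ : Euc n → ℝ) (x : Euc n) :
    Matrix (Fin n) (Fin n) ℝ :=
  Matrix.of fun i j =>
    fderiv ℝ (fderiv ℝ φ) x (EuclideanSpace.single i 1) (EuclideanSpace.single j 1)

theorem hessianMatrix_mem {n : ℕ} {φ : Euc n → ℝ} {x : Euc n} (h : ContDiffAt ℝ 2 φ x) :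
    hessianMatrix φ x ∈ symMat n := by
  apply Matrix.IsSymm.ext
  intro i j
  exact (h.isSymmSndFDerivAt (by simp)).eq _ _

/-- `F[φ](x) = ∇²φ(x) + L(x, ∇φ(x))`, for a function `φ` that is `C²` near `x`. -/
noncomputable def opF {n : ℕ} (L : Euc n × Euc n → symMat n) (φ : Euc n → ℝ) (x : Euc n)
    (h : ContDiffAt ℝ 2 φ x) : symMat n :=
  ⟨hessianMatrix φ x, hessianMatrix_mem h⟩ + L (x, gradient φ x)

/-- `F[u] ∈ 𝒮 \ U` in `Ω` in the viscosity sense: every `C²` function on `Ω` that touches `u`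
from below at a point of `Ω` satisfies `F[φ] ∉ U` there. (For open `Ω` the hypothesis `h` is
implied by `ContDiffOn ℝ 2 φ Ω`; it only serves to form the symmetric matrix `F[φ](x₀)`.) -/
def ViscosityNotMem {n : ℕ} (Ω : Set (Euc n)) (L : Euc n × Euc n → symMat n)
    (U : Set (symMat n)) (u : Euc n → ℝ) : Prop :=
  ∀ x₀ ∈ Ω, ∀ φ : Euc n → ℝ, ContDiffOn ℝ 2 φ Ω → ∀ h : ContDiffAt ℝ 2 φ x₀,
    φ x₀ = u x₀ → (∀ᶠ x in 𝓝 x₀, φ x ≤ u x) → opF L φ x₀ h ∉ U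

/-- `F[v] ∈ closure U` in `Ω` in the viscosity sense: every `C²` function on `Ω` that touches
`v` from above at a point of `Ω` satisfies `F[φ] ∈ closure U` there. -/
def ViscosityMemClosure {n : ℕ} (Ω : Set (Euc n)) (L : Euc n × Euc n → symMat n)
    (U : Set (symMat n)) (v : Euc n → ℝ) : Prop :=
  ∀ x₀ ∈ Ω, ∀ φ : Euc n → ℝ, ContDiffOn ℝ 2 φ Ω → ∀ h : ContDiffAt ℝ 2 φ x₀,
    φ x₀ = v x₀ → (∀ᶠ x in 𝓝 x₀, v x ≤ φ x) → opF L φ x₀ h ∈ closure U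

/-- The structural conditions `0 ∈ ∂U`, `U + 𝒫 ⊆ U` with `𝒫` the non-negative matrices, and
`t U ⊆ U` for all `t > 0`; boundary taken in the space of symmetric matrices. -/
def EllipticCone {n : ℕ} (U : Set (symMat n)) : Prop :=
  (0 : symMat n) ∈ frontier U ∧
  (∀ M ∈ U, ∀ P : symMat n, (P : Matrix (Fin n) (Fin n) ℝ).PosSemidef → M + P ∈ U) ∧
  (∀ t : ℝ, 0 < t → ∀ M ∈ U, t • M ∈ U)

/-- The open cone `C_μ(ν) = {t (ν ⊗ ν + A) : A symmetric, ‖A‖ < μ, t > 0}`. -/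
def coneAbout {n : ℕ} (μ : ℝ) (ν : Euc n) : Set (symMat n) :=
  {B | ∃ t : ℝ, 0 < t ∧ ∃ A : symMat n, ‖A‖ < μ ∧ B = t • (tensorSq ν + A)}

/-- Condition `U_ν`: there is `μ > 0` with `U + C_μ(ν) ⊆ U`. -/
def ConditionU {n : ℕ} (U : Set (symMat n)) (ν : Euc n) : Prop :=
  ∃ μ : ℝ, 0 < μ ∧ ∀ M ∈ U, ∀ B ∈ coneAbout μ ν, M + B ∈ U

/-- `x₀` is a boundary point of `Ω`, the boundary of `Ω` is `C²` near `x₀`, and `ν` is the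
interior unit normal of `∂Ω` at `x₀`: near `x₀` the set `Ω` is `{ρ > 0}` and its boundary is
`{ρ = 0}` for a `C²` function `ρ` without critical points, and `ν` is the normalized gradient
of `ρ` at `x₀`. -/
def IsC2BoundaryWithInteriorNormal {n : ℕ} (Ω : Set (Euc n)) (x₀ ν : Euc n) : Prop :=
  x₀ ∈ frontier Ω ∧
  ∃ (N : Set (Euc n)) (ρ : Euc n → ℝ), IsOpen N ∧ x₀ ∈ N ∧ ContDiffOn ℝ 2 ρ N ∧
    (∀ x ∈ N, gradient ρ x ≠ 0) ∧
    Ω ∩ N = {x | x ∈ N ∧ 0 < ρ x} ∧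
    frontier Ω ∩ N = {x | x ∈ N ∧ ρ x = 0} ∧
    ν = ‖gradient ρ x₀‖⁻¹ • gradient ρ x₀

/-! The argument is Hopf's barrier method, made rigorous for viscosity solutions. A ball `{q > 0}`
touches the boundary at the given point from inside Ω, with `q = ballFun`, and the barrier is `h = q
+ (α/2) q²`. Its Hessian is `α ∇q ⊗ ∇q - 2κ (1 + α q) I`, with `∇q` close to `ν` near the boundary
point. For large `α` and small distance, the Hessian of `ε h` together with the change of `L` caused
by its gradient is `εα (ν ⊗ ν + A)` with `‖A‖ < μ`. Adding `ε h` to `v` thus moves `F` from `closure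
U` into `U`, so `v + ε h` is a strict subsolution. It lies below `u` on the boundary of a small
lens: `h = 0` on the sphere `{q = 0}`, and on the remaining part `u - v` is bounded below.
Comparison (`comparison_barrier`) gives `u ≥ v + ε h` in the lens, and `h` grows linearly along `ν`.

Comparison doubles the variables through a third point `z`, with penalty `c‖x - z‖² + c‖y - z‖²`.
Maximising in `x` and `y` replaces the functions by a semiconvex `F` and a semiconcave `G`. Let `Γ`
be the infimum of the affine functions of small slope that touch `F - G` from above. Between `F` and
`G + Γ` there is a function `W` with Lipschitz gradient (`exists_lipschitz_gradient_between`). The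
contact points are not null, because `∇W` maps the corresponding set for `F - G` and `Γ` onto a
ball; hence Rademacher's theorem provides one where `∇W` is differentiable. The Taylor polynomial of
`W` there tests both functions with the same second order part (`exists_common_quadratic`,
`exists_doubling_point`). -/

/-! ### Convex analysis: insertion of a function with Lipschitz gradient. -/

section ConvexAnalysis

open scoped RealInnerProductSpace

variable {E : Type*} [NormedAddCommGroup E] [InnerProductSpace ℝ E]

/-- A convex function on a finite-dimensional space has a subgradient at every point. -/
theorem ConvexOn.exists_subgradient [FiniteDimensional ℝ E] {f : E → ℝ}
    (hf : ConvexOn ℝ univ f) (x : E) : ∃ p : E, ∀ y, f x + ⟪p, y - x⟫ ≤ f y := by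
  have hcont : Continuous f := hf.locallyLipschitz.continuous
  have hconv := hf.convex_strict_epigraph
  have hopen : IsOpen {a : E × ℝ | a.1 ∈ univ ∧ f a.1 < a.2} := by
    simp only [mem_univ, true_and]
    exact isOpen_lt (hcont.comp continuous_fst) continuous_snd
  obtain ⟨T, hT⟩ := geometric_hahn_banach_open_point hconv hopen
    (x := (x, f x)) (by simp)
  have hsplit : ∀ y t, T (y, t) = T (y, 0) + t * T (0, 1) := by
    intro y t
    have : ((y, t) : E × ℝ) = (y, 0) + t • (0, 1) := by simp
    rw [this, map_add, map_smul, smul_eq_mul]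
  -- The separating hyperplane is not vertical, so it is the graph of an affine function.
  have hβ : T (0, 1) < 0 := by
    have := hT (x, f x + 1) (by simp)
    rw [hsplit x (f x + 1), hsplit x (f x)] at this
    linarith
  set β := -T (0, 1) with hβdef
  have hβ' : 0 < β := by linarith
  refine ⟨β⁻¹ • (InnerProductSpace.toDual ℝ E).symm
    (T.comp (ContinuousLinearMap.inl ℝ E ℝ)), fun y => ?_⟩
  rw [inner_smul_left, InnerProductSpace.toDual_symm_apply]
  have h1 : ∀ t, f y < t → T (y, 0) - T (x, 0) + f x * β ≤ t * β := by
    intro t ht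
    have := hT (y, t) (by simpa using ht)
    rw [hsplit y t, hsplit x (f x)] at this
    simp only [hβdef]
    linarith
  have h2 : T (y, 0) - T (x, 0) + f x * β ≤ f y * β := by
    have h3 : (T (y, 0) - T (x, 0) + f x * β) / β ≤ f y :=
      le_of_forall_gt_imp_ge_of_dense fun t ht => by
        rw [div_le_iff₀ hβ']
        exact h1 t ht
    rwa [div_le_iff₀ hβ'] at h3
  have h4 : (T.comp (ContinuousLinearMap.inl ℝ E ℝ)) (y - x) = T (y, 0) - T (x, 0) := by
    simp [← map_sub]
  rw [h4]
  simp only [map_inv₀, conj_trivial]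
  rw [inv_mul_eq_div, ← sub_nonneg]
  have : f y - (f x + (T (y, 0) - T (x, 0)) / β)
      = (f y * β - (T (y, 0) - T (x, 0) + f x * β)) / β := by
    field_simp
    ring
  rw [this]
  exact div_nonneg (by linarith) hβ'.le

/-- A function lying between its tangent planes and tangent paraboloids is differentiable. -/
theorem hasGradientAt_of_quadratic_bounds [CompleteSpace E] {W : E → ℝ} {p : E} {x : E} {C : ℝ}
    (hlow : ∀ y, W x + ⟪p, y - x⟫ ≤ W y)
    (hup : ∀ y, W y ≤ W x + ⟪p, y - x⟫ + C * ‖y - x‖ ^ 2) : HasGradientAt W p x := by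
  rw [hasGradientAt_iff_isLittleO]
  have h1 : (fun y => W y - W x - ⟪p, y - x⟫) =O[𝓝 x] fun y => ‖y - x‖ ^ 2 := by
    refine Asymptotics.IsBigO.of_bound C (Eventually.of_forall fun y => ?_)
    rw [Real.norm_of_nonneg (by linarith [hlow y]), Real.norm_of_nonneg (by positivity)]
    linarith [hup y]
  refine h1.trans_isLittleO ?_
  have h2 : (fun y : E => ‖y - x‖ ^ 2) = fun y => ‖y - x‖ * ‖y - x‖ := by
    ext y; ring
  rw [h2]
  have h3 : (fun y : E => ‖y - x‖) =o[𝓝 x] fun _ => (1 : ℝ) := by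
    rw [Asymptotics.isLittleO_one_iff]
    have : ContinuousAt (fun y : E => ‖y - x‖) x := by fun_prop
    simpa [ContinuousAt] using this
  have := h3.mul_isBigO (Asymptotics.isBigO_refl (fun y : E => ‖y - x‖) (𝓝 x))
  simpa using this.norm_right

/-- The gradient of a function lying between its tangent planes and tangent paraboloids is
Lipschitz. -/
theorem lipschitzWith_of_quadratic_bounds {W : E → ℝ} {p : E → E} {C : ℝ} (hC : 0 ≤ C)
    (hlow : ∀ x y, W x + ⟪p x, y - x⟫ ≤ W y)
    (hup : ∀ x y, W y ≤ W x + ⟪p x, y - x⟫ + C * ‖y - x‖ ^ 2) :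
    LipschitzWith (Real.toNNReal (4 * C)) p := by
  refine LipschitzWith.of_dist_le_mul fun x y => ?_
  rw [Real.coe_toNNReal _ (by positivity), dist_comm (p x), dist_comm x, dist_eq_norm,
    dist_eq_norm]
  rcases eq_or_ne (p y - p x) 0 with h0 | h0
  · rw [h0, norm_zero]; positivity
  set e := p y - p x with he
  set d := ‖y - x‖ with hd
  have hepos : 0 < ‖e‖ := norm_pos_iff.mpr h0
  -- Move from `y` by `d = ‖y - x‖` along the gradient difference: the tangent plane at `y` gains
  -- `d‖e‖` over that at `x`, while the paraboloid at `x` allows at most `C (2d)²`.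
  set z := y + (d / ‖e‖) • e with hz
  have h1 := hlow y z
  have h2 := hup x z
  have h3 := hlow x y
  have hzy : z - y = (d / ‖e‖) • e := by simp [hz]
  have hsplit : z - x = (z - y) + (y - x) := by abel
  have hnz : ‖z - y‖ = d := by
    rw [hzy, norm_smul, Real.norm_of_nonneg (by positivity), div_mul_cancel₀ _ hepos.ne']
  have h4 : ‖z - x‖ ≤ 2 * d := by
    rw [hsplit]
    refine (norm_add_le _ _).trans ?_
    rw [hnz]; linarith
  have h5 : ⟪p y, z - y⟫ - ⟪p x, z - y⟫ = d * ‖e‖ := by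
    rw [← inner_sub_left, ← he, hzy, inner_smul_right, real_inner_self_eq_norm_sq]
    field_simp
  rw [hsplit, inner_add_right, ← hsplit] at h2
  have h6 : ‖z - x‖ ^ 2 ≤ (2 * d) ^ 2 := by gcongr
  have h7 : d * ‖e‖ ≤ C * (2 * d) ^ 2 := by nlinarith
  rcases eq_or_ne d 0 with hd0 | hd0
  · have : y = x := by rwa [hd, norm_eq_zero, sub_eq_zero] at hd0
    exact absurd (by simp [he, this]) h0
  · have hdpos : 0 < d := lt_of_le_of_ne (norm_nonneg _) hd0.symm
    have : d * ‖e‖ ≤ d * (4 * C * d) := by nlinarith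
    exact le_of_mul_le_mul_left this hdpos

/-- Convexity gives a supporting plane from below, concavity of `W - C‖·‖²` a paraboloid from above.
Both touch at the same point, so their slopes agree and the quadratic bounds apply. -/
theorem ConvexOn.exists_lipschitz_gradient [FiniteDimensional ℝ E] [CompleteSpace E]
    {W : E → ℝ} {C : ℝ} (hC : 0 ≤ C) (hW : ConvexOn ℝ univ W)
    (hW' : ConcaveOn ℝ univ fun z => W z - C * ‖z‖ ^ 2) :
    ∃ (p : E → E) (K : NNReal), LipschitzWith K p ∧ ∀ z, HasGradientAt W (p z) z := by
  choose p hp using hW.exists_subgradient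
  choose q hq using hW'.neg.exists_subgradient
  have hup : ∀ x y, W y ≤ W x + ⟪p x, y - x⟫ + C * ‖y - x‖ ^ 2 := by
    intro x
    have hq1 : ∀ y, W y ≤ W x + ⟪(2 * C) • x - q x, y - x⟫ + C * ‖y - x‖ ^ 2 := by
      intro y
      have h := hq x y
      simp only [Pi.neg_apply] at h
      have h2 : ‖y‖ ^ 2 = ‖x‖ ^ 2 + 2 * ⟪x, y - x⟫ + ‖y - x‖ ^ 2 := by
        rw [← norm_add_sq_real]; simp
      rw [inner_sub_left, inner_smul_left]
      simp only [conj_trivial]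
      rw [h2] at h
      linarith
    have heq : p x = (2 * C) • x - q x := by
      rw [← sub_eq_zero]
      -- Testing both bounds at `x + e / (C + 1)` yields `(C + 1)‖e‖² ≤ C‖e‖²`; the shift by one
      -- also covers `C = 0`.
      set e := p x - ((2 * C) • x - q x) with he
      have h1 := hp x (x + (C + 1)⁻¹ • e)
      have h2 := hq1 (x + (C + 1)⁻¹ • e)
      rw [add_sub_cancel_left] at h1 h2
      have h3 : ⟪e, (C + 1)⁻¹ • e⟫ ≤ C * ‖(C + 1)⁻¹ • e‖ ^ 2 := by
        nth_rewrite 1 [he]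
        rw [inner_sub_left]; linarith
      have hC1 : 0 < C + 1 := by linarith
      rw [inner_smul_right, real_inner_self_eq_norm_sq, norm_smul,
        Real.norm_of_nonneg (by positivity)] at h3
      have h4 : ‖e‖ ^ 2 * (C + 1) ≤ C * ‖e‖ ^ 2 := by
        have h5 : (C + 1)⁻¹ * ‖e‖ ^ 2 * (C + 1) ^ 2 ≤ C * ((C + 1)⁻¹ * ‖e‖) ^ 2 * (C + 1) ^ 2 := by
          gcongr
        have h6 : (C + 1)⁻¹ * ‖e‖ ^ 2 * (C + 1) ^ 2 = ‖e‖ ^ 2 * (C + 1) := by field_simp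
        have h7 : C * ((C + 1)⁻¹ * ‖e‖) ^ 2 * (C + 1) ^ 2 = C * ‖e‖ ^ 2 := by field_simp
        linarith
      have h8 : ‖e‖ ^ 2 ≤ 0 := by linarith
      exact norm_eq_zero.mp (pow_eq_zero_iff (two_ne_zero) |>.mp (le_antisymm h8 (by positivity)))
    rw [heq]
    exact hq1
  exact ⟨p, _, lipschitzWith_of_quadratic_bounds hC hp hup,
    fun z => hasGradientAt_of_quadratic_bounds (hp z) (hup z)⟩

/-- Between a semiconvex function and a semiconcave function above it there is a function with
Lipschitz gradient. -/
theorem exists_lipschitz_gradient_between [FiniteDimensional ℝ E] [CompleteSpace E]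
    {F G : E → ℝ} {c : ℝ} (hc : 0 ≤ c) (hF : ConvexOn ℝ univ fun z => F z + c * ‖z‖ ^ 2)
    (hG : ConcaveOn ℝ univ fun z => G z - c * ‖z‖ ^ 2) (hFG : ∀ z, F z ≤ G z) :
    ∃ (W : E → ℝ) (p : E → E) (K : NNReal), LipschitzWith K p ∧
      (∀ z, HasGradientAt W (p z) z) ∧ ∀ z, F z ≤ W z ∧ W z ≤ G z := by
  set G₁ : E → ℝ := fun z => G z + c * ‖z‖ ^ 2 with hG₁
  set S : E → Set ℝ := fun z =>
    {t | ∃ ψ : E → ℝ, ConvexOn ℝ univ ψ ∧ (∀ y, ψ y ≤ G₁ y) ∧ ψ z = t} with hS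
  have hbdd : ∀ z, BddAbove (S z) := fun z => ⟨G₁ z, by
    rintro t ⟨ψ, -, h, rfl⟩; exact h z⟩
  have hFmem : ∀ z, F z + c * ‖z‖ ^ 2 ∈ S z := fun z =>
    ⟨_, hF, fun y => by simp only [hG₁]; linarith [hFG y], rfl⟩
  -- `W` is the convex envelope of `G₁`; subtracting `c‖z‖²` at the end gives the inserted function.
  set W : E → ℝ := fun z => sSup (S z) with hW
  have hle : ∀ ψ : E → ℝ, ConvexOn ℝ univ ψ → (∀ y, ψ y ≤ G₁ y) → ∀ z, ψ z ≤ W z :=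
    fun ψ h1 h2 z => le_csSup (hbdd z) ⟨ψ, h1, h2, rfl⟩
  have hWG : ∀ z, W z ≤ G₁ z := fun z => csSup_le ⟨_, hFmem z⟩ (by
    rintro t ⟨ψ, -, h, rfl⟩; exact h z)
  have hconv : ConvexOn ℝ univ W := by
    refine ⟨convex_univ, fun x _ y _ s t hs ht hst => ?_⟩
    refine csSup_le ⟨_, hFmem _⟩ ?_
    rintro _ ⟨ψ, h1, h2, rfl⟩
    refine (h1.2 (mem_univ x) (mem_univ y) hs ht hst).trans ?_
    have hx := hle ψ h1 h2 x
    have hy := hle ψ h1 h2 y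
    simp only [smul_eq_mul]
    gcongr
  have hconc : ConcaveOn ℝ univ fun z => W z - 2 * c * ‖z‖ ^ 2 := by
    refine ⟨convex_univ, fun x _ y _ s t hs ht hst => ?_⟩
    set m := s • x + t • y with hm
    set k := 2 * c * (s * ‖x‖ ^ 2 + t * ‖y‖ ^ 2 - ‖m‖ ^ 2) with hk
    have hshift : ∀ w : E, ConvexOn ℝ univ fun z => W (z + w) := fun w => by
      have := hconv.translate_left w
      simpa [Function.comp_def] using this
    -- An average of translates of `W`, lowered by `k`, is itself a competitor for the envelope; at
    -- `z = m` this is the concavity inequality.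
    have h1 : ConvexOn ℝ univ fun z => s * W (z + (x - m)) + t * W (z + (y - m)) - k := by
      have := (((hshift (x - m)).smul hs).add ((hshift (y - m)).smul ht)).add_const (-k)
      refine this.congr fun z _ => ?_
      simp [sub_eq_add_neg]
    have h2 : ∀ z, s * W (z + (x - m)) + t * W (z + (y - m)) - k ≤ G₁ z := by
      intro z
      have hx := hWG (z + (x - m))
      have hy := hWG (z + (y - m))
      have h3 := hG.2 (mem_univ (z + (x - m))) (mem_univ (z + (y - m))) hs ht hst
      have h4 : s • (z + (x - m)) + t • (z + (y - m)) = z := by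
        have : s • (z + (x - m)) + t • (z + (y - m)) = (s + t) • z + (m - (s + t) • m) := by
          rw [hm]; module
        rw [this, hst]; simp
      have hnorm : ∀ w : E, ‖z + (w - m)‖ ^ 2 = ‖w‖ ^ 2 + 2 * ⟪w, z - m⟫ + ‖z - m‖ ^ 2 := by
        intro w
        rw [← norm_add_sq_real]
        congr 2; abel
      have hzm : ‖z‖ ^ 2 = ‖m‖ ^ 2 + 2 * ⟪m, z - m⟫ + ‖z - m‖ ^ 2 := by
        rw [← norm_add_sq_real]
        congr 2; abel
      have hin : ⟪m, z - m⟫ = s * ⟪x, z - m⟫ + t * ⟪y, z - m⟫ := by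
        nth_rewrite 1 [hm]
        rw [inner_add_left, inner_smul_left, inner_smul_left]; simp
      rw [h4] at h3
      simp only [hG₁, smul_eq_mul] at hx hy h3 ⊢
      have ht' : t = 1 - s := by linarith
      have hx' := mul_le_mul_of_nonneg_left hx hs
      have hy' := mul_le_mul_of_nonneg_left hy ht
      have hkey : s * (c * ‖z + (x - m)‖ ^ 2) + t * (c * ‖z + (y - m)‖ ^ 2)
          = c * ‖z‖ ^ 2 + k / 2 := by
        rw [hnorm x, hnorm y, hzm, hin, hk, ht']; ring
      nlinarith
    have h3 := hle _ h1 h2 m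
    simp only [add_sub_cancel] at h3
    simp only [smul_eq_mul]
    rw [hk] at h3
    linarith
  obtain ⟨p, K, hp, hgrad⟩ := hconv.exists_lipschitz_gradient (by positivity : 0 ≤ 2 * c) hconc
  refine ⟨fun z => W z - c * ‖z‖ ^ 2, fun z => p z - (2 * c) • z, K + Real.toNNReal (2 * c), ?_,
    fun z => ?_, fun z => ⟨?_, ?_⟩⟩
  · refine hp.sub ?_
    refine LipschitzWith.of_dist_le_mul fun x y => ?_
    rw [dist_smul₀, Real.coe_toNNReal _ (by positivity), Real.norm_of_nonneg (by positivity)]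
  · rw [hasGradientAt_iff_hasFDerivAt]
    have h1 := (hgrad z).hasFDerivAt
    have h2 := ((hasStrictFDerivAt_norm_sq z).hasFDerivAt.const_mul c)
    refine (h1.sub h2).congr_fderiv ?_
    ext w
    simp
    ring
  · have := hle _ hF (fun y => by simp only [hG₁]; linarith [hFG y]) z
    simp only at this ⊢
    linarith
  · have := hWG z
    simp only [hG₁] at this ⊢
    linarith

/-- Second order Taylor expansion at a point where the gradient is differentiable. -/
theorem eventually_abs_taylor_le [CompleteSpace E] {W : E → ℝ} {p : E → E} {A : E →L[ℝ] E}
    {z₀ : E} (hW : ∀ z, HasGradientAt W (p z) z) (hp : HasFDerivAt p A z₀) {η : ℝ} (hη : 0 < η) :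
    ∀ᶠ z in 𝓝 z₀, |W z - W z₀ - ⟪p z₀, z - z₀⟫ - 1 / 2 * ⟪A (z - z₀), z - z₀⟫|
      ≤ η * ‖z - z₀‖ ^ 2 := by
  have h1 := hp.isLittleO.def hη
  obtain ⟨δ, hδ, hball⟩ := Metric.eventually_nhds_iff_ball.mp h1
  refine Metric.eventually_nhds_iff_ball.mpr ⟨δ, hδ, fun z hz => ?_⟩
  set e := z - z₀ with he
  -- The Taylor remainder is estimated by the mean value inequality along the segment from `z₀` to
  -- `z`.
  have hderiv : ∀ t : ℝ, HasDerivAt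
      (fun t : ℝ => W (z₀ + t • e) - t * ⟪p z₀, e⟫ - t ^ 2 / 2 * ⟪A e, e⟫)
      (⟪p (z₀ + t • e), e⟫ - ⟪p z₀, e⟫ - t * ⟪A e, e⟫) t := by
    intro t
    have h2 : HasDerivAt (fun t : ℝ => z₀ + t • e) e t := by
      simpa using ((hasDerivAt_id t).smul_const e).const_add z₀
    have h3 := (hW (z₀ + t • e)).hasFDerivAt.comp_hasDerivAt t h2
    have h4 := (hasDerivAt_id t).mul_const ⟪p z₀, e⟫
    have h5 := (((hasDerivAt_id t).pow 2).div_const 2).mul_const ⟪A e, e⟫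
    refine ((h3.sub h4).sub h5).congr_deriv ?_
    simp
  have hbound : ∀ t ∈ Icc (0 : ℝ) 1,
      ‖⟪p (z₀ + t • e), e⟫ - ⟪p z₀, e⟫ - t * ⟪A e, e⟫‖ ≤ η * ‖e‖ ^ 2 := by
    intro t ht
    have hmem : z₀ + t • e ∈ Metric.ball z₀ δ := by
      rw [mem_ball_iff_norm, add_sub_cancel_left, norm_smul, Real.norm_of_nonneg ht.1]
      rw [mem_ball_iff_norm, ← he] at hz
      nlinarith [norm_nonneg e, ht.2]
    have h2 := hball _ hmem
    rw [add_sub_cancel_left, map_smul, norm_smul, Real.norm_of_nonneg ht.1] at h2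
    have h3 : ⟪p (z₀ + t • e), e⟫ - ⟪p z₀, e⟫ - t * ⟪A e, e⟫
        = ⟪p (z₀ + t • e) - p z₀ - t • A e, e⟫ := by
      rw [inner_sub_left, inner_sub_left, inner_smul_left]; simp
    rw [h3]
    refine (norm_inner_le_norm _ _).trans ?_
    have : η * (t * ‖e‖) ≤ η * ‖e‖ := by
      have : t * ‖e‖ ≤ 1 * ‖e‖ := by gcongr; exact ht.2
      nlinarith
    calc _ ≤ (η * ‖e‖) * ‖e‖ := by gcongr; linarith
      _ = _ := by ring
  have := (convex_Icc (0 : ℝ) 1).norm_image_sub_le_of_norm_hasDerivWithin_le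
    (fun t _ => (hderiv t).hasDerivWithinAt) hbound (left_mem_Icc.mpr zero_le_one)
    (right_mem_Icc.mpr zero_le_one)
  simp only [one_smul, zero_smul, add_zero, sub_zero, norm_one, mul_one, Real.norm_eq_abs] at this
  have hz' : z₀ + e = z := by simp [he]
  rw [hz'] at this
  convert this using 2
  ring

end ConvexAnalysis

/-! ### Contact sets, sup-convolutions and doubling of variables. -/

section Contact

open scoped RealInnerProductSpace
open MeasureTheory Measure

variable {E : Type*} [NormedAddCommGroup E] [InnerProductSpace ℝ E]

theorem convexOn_of_subgradient {f : E → ℝ} {p : E → E}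
    (hp : ∀ x y, f x + ⟪p x, y - x⟫ ≤ f y) : ConvexOn ℝ univ f := by
  refine ⟨convex_univ, fun x _ y _ s t hs ht hst => ?_⟩
  set m := s • x + t • y with hm
  have h1 := mul_le_mul_of_nonneg_left (hp m x) hs
  have h2 := mul_le_mul_of_nonneg_left (hp m y) ht
  have h3 : s * ⟪p m, x - m⟫ + t * ⟪p m, y - m⟫ = 0 := by
    have : s • (x - m) + t • (y - m) = 0 := by
      have : s • (x - m) + t • (y - m) = m - (s + t) • m := by rw [hm]; module
      rw [this, hst]; simp
    rw [← real_inner_smul_right, ← real_inner_smul_right, ← inner_add_right, this,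
      inner_zero_right]
  have h4 : s * f m + t * f m = f m := by rw [← add_mul, hst, one_mul]
  simp only [smul_eq_mul]
  linarith

theorem concaveOn_sub_sq {Γ : E → ℝ} (hΓ : ConcaveOn ℝ univ Γ) {c : ℝ} (hc : 0 ≤ c) :
    ConcaveOn ℝ univ fun z => Γ z - c * ‖z‖ ^ 2 := by
  have h1 : ConvexOn ℝ univ fun z : E => ‖z‖ ^ 2 :=
    convexOn_univ_norm.pow (fun _ _ => norm_nonneg _) 2
  exact hΓ.sub (h1.smul hc)

/-- The set of points at which a semiconvex function, perturbed by a small linear functional,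
attains its maximum is not a null set. -/
theorem hausdorffMeasure_contact_ne_zero [FiniteDimensional ℝ E] [CompleteSpace E]
    [MeasurableSpace E] [BorelSpace E] {w Γ : E → ℝ} {c r : ℝ} (hc : 0 ≤ c) (hr : 0 < r)
    (hw : ConvexOn ℝ univ fun z => w z + c * ‖z‖ ^ 2) (hΓ : ConcaveOn ℝ univ Γ)
    (hwΓ : ∀ z, w z ≤ Γ z) {ζ : E → E}
    (hζ : ∀ p, ‖p‖ ≤ r → ∀ y, Γ y ≤ w (ζ p) + ⟪p, y - ζ p⟫) :
    μH[Module.finrank ℝ E] (ζ '' Metric.closedBall 0 r) ≠ 0 := by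
  obtain ⟨W, q, K, hq, hgrad, hW⟩ :=
    exists_lipschitz_gradient_between hc hw (concaveOn_sub_sq hΓ hc) hwΓ
  intro h0
  -- `W` is squeezed between `w` and `Γ`, so `W - ⟪p, ·⟫` has its maximum at `ζ p` and `q (ζ p) =
  -- p`. A Lipschitz map cannot send a null set onto a ball.
  have h1 : Metric.closedBall (0 : E) r ⊆ q '' (ζ '' Metric.closedBall 0 r) := by
    intro p hp
    rw [mem_closedBall_zero_iff] at hp
    refine ⟨ζ p, ⟨p, by simpa using hp, rfl⟩, ?_⟩
    have hmax : IsLocalMax (fun y => W y - ⟪p, y⟫) (ζ p) := by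
      refine Eventually.of_forall fun y => ?_
      have h2 := hζ p hp y
      have h3 := (hW y).2
      have h4 := (hW (ζ p)).1
      rw [inner_sub_right] at h2
      simp only
      linarith
    have hd : HasFDerivAt (fun y => W y - ⟪p, y⟫)
        (InnerProductSpace.toDual ℝ E (q (ζ p)) - innerSL ℝ p) (ζ p) :=
      (hgrad (ζ p)).hasFDerivAt.sub (innerSL ℝ p).hasFDerivAt
    have h5 := hmax.hasFDerivAt_eq_zero hd
    have h6 : ∀ e, ⟪q (ζ p) - p, e⟫ = 0 := fun e => by
      have := congrArg (fun T : E →L[ℝ] ℝ => T e) h5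
      simpa [inner_sub_left] using this
    have := h6 (q (ζ p) - p)
    rw [inner_self_eq_zero, sub_eq_zero] at this
    exact this
  have h2 := hq.hausdorffMeasure_image_le (d := Module.finrank ℝ E) (by positivity)
    (ζ '' Metric.closedBall 0 r)
  rw [h0, mul_zero] at h2
  have h3 : μH[Module.finrank ℝ E] (Metric.closedBall (0 : E) r) ≤ 0 :=
    (measure_mono h1).trans h2
  exact absurd h3 (Metric.measure_closedBall_pos _ _ hr).not_ge

/-- If a semiconvex function minus a semiconcave one has a maximum under all small linear
perturbations, then at some such maximum point a common quadratic polynomial touches the first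
from above and, up to a small linear term, the second from below, to second order. -/
theorem exists_common_quadratic [FiniteDimensional ℝ E] [CompleteSpace E]
    {F G : E → ℝ} {c r : ℝ} (hc : 0 ≤ c) (hr : 0 < r)
    (hF : ConvexOn ℝ univ fun z => F z + c * ‖z‖ ^ 2)
    (hG : ConcaveOn ℝ univ fun z => G z - c * ‖z‖ ^ 2)
    (hmax : ∀ p : E, ‖p‖ ≤ r → ∃ z, ∀ y, F y - G y - ⟪p, y⟫ ≤ F z - G z - ⟪p, z⟫) :
    ∃ (z₀ p P : E) (A : E →L[ℝ] E), ‖p‖ ≤ r ∧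
      (∀ y, F y - G y - ⟪p, y⟫ ≤ F z₀ - G z₀ - ⟪p, z₀⟫) ∧
      ∀ η > 0, ∀ᶠ z in 𝓝 z₀,
        F z ≤ F z₀ + ⟪P, z - z₀⟫ + 1 / 2 * ⟪A (z - z₀), z - z₀⟫ + η * ‖z - z₀‖ ^ 2 ∧
        G z₀ + ⟪P - p, z - z₀⟫ + 1 / 2 * ⟪A (z - z₀), z - z₀⟫ - η * ‖z - z₀‖ ^ 2 ≤ G z := by
  borelize E
  have hmax' : ∀ p : E, ∃ z, ‖p‖ ≤ r → ∀ y, F y - G y - ⟪p, y⟫ ≤ F z - G z - ⟪p, z⟫ := by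
    intro p
    by_cases hp : ‖p‖ ≤ r
    · obtain ⟨z, hz⟩ := hmax p hp
      exact ⟨z, fun _ => hz⟩
    · exact ⟨0, fun h => absurd h hp⟩
  choose ζ hζ using hmax'
  set w : E → ℝ := fun z => F z - G z with hw
  have hwconv : ConvexOn ℝ univ fun z => w z + 2 * c * ‖z‖ ^ 2 := by
    refine (hF.sub hG).congr fun z _ => ?_
    simp only [hw, Pi.sub_apply]; ring
  set Γ : E → ℝ := fun y => ⨅ p : Metric.closedBall (0 : E) r, (w (ζ p) + ⟪(p : E), y - ζ p⟫)
    with hΓ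
  have : Nonempty (Metric.closedBall (0 : E) r) := ⟨⟨0, by simp [hr.le]⟩⟩
  have hplane : ∀ (p : Metric.closedBall (0 : E) r) y, w y ≤ w (ζ p) + ⟪(p : E), y - ζ p⟫ := by
    intro p y
    have := hζ p (mem_closedBall_zero_iff.mp p.2) y
    rw [inner_sub_right]
    simp only [hw]
    linarith
  have hbdd : ∀ y, BddBelow (range fun p : Metric.closedBall (0 : E) r =>
      w (ζ p) + ⟪(p : E), y - ζ p⟫) := fun y => ⟨w y, by
    rintro _ ⟨p, rfl⟩; exact hplane p y⟩
  have hΓle : ∀ p : E, ‖p‖ ≤ r → ∀ y, Γ y ≤ w (ζ p) + ⟪p, y - ζ p⟫ := fun p hp y =>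
    ciInf_le (hbdd y) ⟨p, by simpa using hp⟩
  have hwΓ : ∀ y, w y ≤ Γ y := fun y => le_ciInf fun p => hplane p y
  have hΓconc : ConcaveOn ℝ univ Γ := by
    refine ⟨convex_univ, fun x _ y _ s t hs ht hst => le_ciInf fun p => ?_⟩
    have h1 := mul_le_mul_of_nonneg_left (ciInf_le (hbdd x) p) hs
    have h2 := mul_le_mul_of_nonneg_left (ciInf_le (hbdd y) p) ht
    have h3 : w (ζ p) + ⟪(p : E), s • x + t • y - ζ p⟫ = s * (w (ζ p) + ⟪(p : E), x - ζ p⟫)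
        + t * (w (ζ p) + ⟪(p : E), y - ζ p⟫) := by
      have ht' : t = 1 - s := by linarith
      rw [inner_sub_right, inner_add_right, inner_smul_right, inner_smul_right,
        inner_sub_right, inner_sub_right, ht']
      ring
    rw [h3]
    exact add_le_add h1 h2
  have hpos := hausdorffMeasure_contact_ne_zero (by positivity) hr hwconv hΓconc hwΓ hΓle
  have hGΓ : ConcaveOn ℝ univ fun z => (G z + Γ z) - c * ‖z‖ ^ 2 := by
    refine (hG.add hΓconc).congr fun z _ => ?_
    simp only [Pi.add_apply]; ring
  -- At a contact point `F = W = G + Γ`, and `Γ` lies below the plane of slope `p`. An expansion of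
  -- `W` thus bounds `F` from above and `G` from below, the latter with gradient shifted by `p`.
  obtain ⟨W, q, K, hq, hgrad, hW⟩ := exists_lipschitz_gradient_between hc hF hGΓ
    (fun z => by have := hwΓ z; simp only [hw] at this; linarith)
  have hae := hq.ae_differentiableAt (μ := μH[Module.finrank ℝ E])
  have : ∃ z ∈ ζ '' Metric.closedBall 0 r, DifferentiableAt ℝ q z := by
    by_contra! hcon
    exact hpos (measure_mono_null (fun z hz => hcon z hz) (ae_iff.mp hae))
  obtain ⟨_, ⟨p, hp, rfl⟩, hdiff⟩ := this
  rw [mem_closedBall_zero_iff] at hp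
  have h1 : Γ (ζ p) = w (ζ p) :=
    le_antisymm (by simpa using hΓle p hp (ζ p)) (hwΓ _)
  have h2 : W (ζ p) = F (ζ p) := by
    refine le_antisymm ?_ (hW _).1
    have := (hW (ζ p)).2
    rw [h1] at this
    simp only [hw] at this
    linarith
  refine ⟨ζ p, p, q (ζ p), fderiv ℝ q (ζ p), hp, hζ p hp, fun η hη => ?_⟩
  filter_upwards [eventually_abs_taylor_le hgrad hdiff.hasFDerivAt hη] with z hz
  rw [abs_le] at hz
  have h3 := hW z
  have h4 := hΓle p hp z
  simp only [hw] at h4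
  rw [inner_sub_left]
  constructor <;> linarith [hz.1, hz.2, h3.1, h3.2]

/-- After adding `c‖z‖²` the sup-convolution is a supremum of affine functions of `z`; a maximiser
`ξ z` gives the subgradient `2c ξ z`. -/
theorem exists_sup_convolution {D : Set E} (hD : IsCompact D) (hne : D.Nonempty) {a : E → ℝ}
    (ha : ContinuousOn a D) (c : ℝ) :
    ∃ (F : E → ℝ) (ξ : E → E), (∀ z, ξ z ∈ D ∧ F z = a (ξ z) - c * ‖ξ z - z‖ ^ 2) ∧
      (∀ x ∈ D, ∀ z, a x - c * ‖x - z‖ ^ 2 ≤ F z) ∧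
      ConvexOn ℝ univ fun z => F z + c * ‖z‖ ^ 2 := by
  have h1 : ∀ z, ∃ x ∈ D, ∀ y ∈ D, a y - c * ‖y - z‖ ^ 2 ≤ a x - c * ‖x - z‖ ^ 2 := fun z =>
    hD.exists_isMaxOn hne (ha.sub (by fun_prop))
  choose ξ hξ hmax using h1
  refine ⟨fun z => a (ξ z) - c * ‖ξ z - z‖ ^ 2, ξ, fun z => ⟨hξ z, rfl⟩,
    fun x hx z => hmax z x hx, convexOn_of_subgradient (p := fun z => (2 * c) • ξ z) ?_⟩
  intro x y
  have h := hmax y (ξ x) (hξ x)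
  simp only
  rw [norm_sub_sq_real] at h ⊢
  rw [inner_smul_left, inner_sub_right]
  simp only [conj_trivial]
  linarith

/-- Completing the square in `z` makes the optimal `z` explicit, so maximising the doubled
functional reduces to the compact set `D ×ˢ D`. -/
theorem sum_sq_add_inner_eq {c : ℝ} (hc : c ≠ 0) (p x y z : E) :
    c * ‖x - z‖ ^ 2 + c * ‖y - z‖ ^ 2 + ⟪p, z⟫ =
      2 * c * ‖z - ((1 / 2 : ℝ) • (x + y) - (1 / (4 * c)) • p)‖ ^ 2 + c / 2 * ‖x - y‖ ^ 2
        + ⟪p, (1 / 2 : ℝ) • (x + y)⟫ - ‖p‖ ^ 2 / (8 * c) := by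
  simp only [← real_inner_self_eq_norm_sq, inner_sub_left, inner_sub_right, inner_add_left,
    inner_add_right, inner_smul_left, inner_smul_right, conj_trivial]
  rw [real_inner_comm p z, real_inner_comm x z, real_inner_comm y z, real_inner_comm x y,
    real_inner_comm p x, real_inner_comm p y]
  field_simp
  ring

/-- A matrix-free form of the theorem on sums for `a x - b y` on a compact set: at a maximum
point of the doubled and linearly perturbed functional, `a` and `b` are touched, from above and
from below respectively, by quadratic polynomials with the same second order part. -/
theorem exists_doubling_point [FiniteDimensional ℝ E] [CompleteSpace E] {D : Set E}
    (hD : IsCompact D) (hne : D.Nonempty) {a b : E → ℝ} (ha : ContinuousOn a D)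
    (hb : ContinuousOn b D) {c r : ℝ} (hc : 0 < c) (hr : 0 < r) :
    ∃ (x₀ y₀ z₀ p P : E) (A : E →L[ℝ] E), x₀ ∈ D ∧ y₀ ∈ D ∧ ‖p‖ ≤ r ∧
      (∀ x ∈ D, ∀ y ∈ D, ∀ z, a x - b y - c * ‖x - z‖ ^ 2 - c * ‖y - z‖ ^ 2 - ⟪p, z⟫ ≤
        a x₀ - b y₀ - c * ‖x₀ - z₀‖ ^ 2 - c * ‖y₀ - z₀‖ ^ 2 - ⟪p, z₀⟫) ∧
      ∀ η > 0,
        (∀ᶠ x in 𝓝 x₀, x ∈ D →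
          a x ≤ a x₀ + ⟪P, x - x₀⟫ + 1 / 2 * ⟪A (x - x₀), x - x₀⟫ + η * ‖x - x₀‖ ^ 2) ∧
        (∀ᶠ y in 𝓝 y₀, y ∈ D →
          b y₀ + ⟪P - p, y - y₀⟫ + 1 / 2 * ⟪A (y - y₀), y - y₀⟫ - η * ‖y - y₀‖ ^ 2 ≤ b y) := by
  obtain ⟨F, ξ, hξ, hFle, hF⟩ := exists_sup_convolution hD hne ha c
  obtain ⟨G', υ, hυ, hGle, hG⟩ := exists_sup_convolution hD hne hb.neg c
  simp only [Pi.neg_apply] at hυ hGle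
  have hG' : ConcaveOn ℝ univ fun z => -G' z - c * ‖z‖ ^ 2 := by
    refine hG.neg.congr fun z _ => ?_
    simp only [Pi.neg_apply]; ring
  obtain ⟨z₀, p, P, A, hp, hmax, htouch⟩ := exists_common_quadratic hc.le hr hF hG' (by
    intro p _
    have hcont : ContinuousOn (fun q : E × E => a q.1 - b q.2 - c / 2 * ‖q.1 - q.2‖ ^ 2
        - ⟪p, (1 / 2 : ℝ) • (q.1 + q.2)⟫) (D ×ˢ D) := by
      refine ((ContinuousOn.sub ?_ ?_).sub (by fun_prop)).sub ?_
      · exact ha.comp continuousOn_fst fun q hq => hq.1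
      · exact hb.comp continuousOn_snd fun q hq => hq.2
      · exact (continuous_const.inner (by fun_prop)).continuousOn
    obtain ⟨⟨x, y⟩, ⟨hx, hy⟩, hxy⟩ := (hD.prod hD).exists_isMaxOn (hne.prod hne) hcont
    refine ⟨(1 / 2 : ℝ) • (x + y) - (1 / (4 * c)) • p, fun z => ?_⟩
    set z₁ := (1 / 2 : ℝ) • (x + y) - (1 / (4 * c)) • p with hz₁
    have h1 := hFle x hx z₁
    have h2 := hGle y hy z₁
    have h3 := sum_sq_add_inner_eq hc.ne' p x y z₁
    have h4 := sum_sq_add_inner_eq hc.ne' p (ξ z) (υ z) z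
    have h5 : a (ξ z) - b (υ z) - c / 2 * ‖ξ z - υ z‖ ^ 2 - ⟪p, (1 / 2 : ℝ) • (ξ z + υ z)⟫
        ≤ a x - b y - c / 2 * ‖x - y‖ ^ 2 - ⟪p, (1 / 2 : ℝ) • (x + y)⟫ :=
      hxy (a := (ξ z, υ z)) ⟨(hξ z).1, (hυ z).1⟩
    rw [← hz₁, sub_self, norm_zero] at h3
    have h6 : 0 ≤ 2 * c * ‖z - ((1 / 2 : ℝ) • (ξ z + υ z) - (1 / (4 * c)) • p)‖ ^ 2 := by
      positivity
    rw [(hξ z).2, (hυ z).2]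
    linarith)
  refine ⟨ξ z₀, υ z₀, z₀, p, P, A, (hξ z₀).1, (hυ z₀).1, hp, fun x hx y hy z => ?_,
    fun η hη => ⟨?_, ?_⟩⟩
  · have h1 := hFle x hx z
    have h2 := hGle y hy z
    have h3 := hmax z
    rw [(hξ z₀).2, (hυ z₀).2] at h3
    linarith
  -- Translating `x` and `z` together keeps the penalty constant, so a quadratic touching `F` at
  -- `z₀` also touches `a` at `ξ z₀`.
  · have htend : Tendsto (fun x => x + (z₀ - ξ z₀)) (𝓝 (ξ z₀)) (𝓝 z₀) := by
      have : ContinuousAt (fun x => x + (z₀ - ξ z₀)) (ξ z₀) := by fun_prop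
      simpa [ContinuousAt] using this
    filter_upwards [htend.eventually (htouch η hη)] with x hx hxD
    have h1 := hFle x hxD (x + (z₀ - ξ z₀))
    have h2 : x + (z₀ - ξ z₀) - z₀ = x - ξ z₀ := by abel
    have h3 : x - (x + (z₀ - ξ z₀)) = ξ z₀ - z₀ := by abel
    have h4 := hx.1
    rw [h2, (hξ z₀).2] at h4
    rw [h3] at h1
    linarith
  · have htend : Tendsto (fun y => y + (z₀ - υ z₀)) (𝓝 (υ z₀)) (𝓝 z₀) := by
      have : ContinuousAt (fun y => y + (z₀ - υ z₀)) (υ z₀) := by fun_prop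
      simpa [ContinuousAt] using this
    filter_upwards [htend.eventually (htouch η hη)] with y hy hyD
    have h1 := hGle y hyD (y + (z₀ - υ z₀))
    have h2 : y + (z₀ - υ z₀) - z₀ = y - υ z₀ := by abel
    have h3 : y - (y + (z₀ - υ z₀)) = υ z₀ - z₀ := by abel
    have h4 := hy.2
    rw [h2, (hυ z₀).2] at h4
    rw [h3] at h1
    linarith

end Contact

/-! ### The barrier, the test functions and their images under the operator. -/

section TestFunctions

open scoped RealInnerProductSpace

variable {n : ℕ}

/-- The identity matrix as a symmetric matrix. -/
def symOne (n : ℕ) : symMat n := ⟨1, Matrix.isSymm_one⟩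

/-- A quadratic polynomial, positive exactly inside the ball of radius `1 / (2 κ)` that touches
`x₀` in the direction of a unit vector `ν`. -/
noncomputable def ballFun (κ : ℝ) (x₀ ν x : Euc n) : ℝ := ⟪ν, x - x₀⟫ - κ * ‖x - x₀‖ ^ 2

/-- The gradient of `ballFun`. -/
noncomputable def ballGrad (κ : ℝ) (x₀ ν x : Euc n) : Euc n := ν - (2 * κ) • (x - x₀)

/-- The barrier function of the Hopf lemma. -/
noncomputable def barrier (κ α : ℝ) (x₀ ν x : Euc n) : ℝ :=
  ballFun κ x₀ ν x + α / 2 * ballFun κ x₀ ν x ^ 2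

/-- A quadratic polynomial minus a multiple of the barrier function. -/
noncomputable def testFun (k η ε κ α : ℝ) (xhat ν x₀ P : Euc n) (A : Euc n →L[ℝ] Euc n)
    (x : Euc n) : ℝ :=
  k + ⟪P, x - x₀⟫ + 1 / 2 * ⟪A (x - x₀), x - x₀⟫ + η * ‖x - x₀‖ ^ 2
    - ε * barrier κ α xhat ν x

/-- The gradient of `testFun`. -/
noncomputable def testGrad (η ε κ α : ℝ) (xhat ν x₀ P : Euc n) (A : Euc n →L[ℝ] Euc n)
    (x : Euc n) : Euc n :=
  P + (1 / 2 : ℝ) • (A (x - x₀) + A.adjoint (x - x₀)) + (2 * η) • (x - x₀)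
    - (ε * (1 + α * ballFun κ xhat ν x)) • ballGrad κ xhat ν x

theorem contDiff_ballFun (κ : ℝ) (x₀ ν : Euc n) {m : WithTop ℕ∞} :
    ContDiff ℝ m (ballFun κ x₀ ν) := by
  unfold ballFun
  exact (contDiff_const.inner ℝ (contDiff_id.sub contDiff_const)).sub
    (contDiff_const.mul ((contDiff_id.sub contDiff_const).norm_sq ℝ))

theorem contDiff_barrier (κ α : ℝ) (x₀ ν : Euc n) {m : WithTop ℕ∞} :
    ContDiff ℝ m (barrier κ α x₀ ν) := by
  have := contDiff_ballFun κ x₀ ν (m := m)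
  unfold barrier
  exact this.add (contDiff_const.mul (this.pow 2))

theorem contDiff_testFun (k η ε κ α : ℝ) (xhat ν x₀ P : Euc n) (A : Euc n →L[ℝ] Euc n)
    {m : WithTop ℕ∞} : ContDiff ℝ m (testFun k η ε κ α xhat ν x₀ P A) := by
  have h1 : ContDiff ℝ m fun x : Euc n => x - x₀ := contDiff_id.sub contDiff_const
  have h2 := contDiff_barrier κ α xhat ν (m := m)
  unfold testFun
  exact (((contDiff_const.add (contDiff_const.inner ℝ h1)).add
    (contDiff_const.mul ((A.contDiff.comp h1).inner ℝ h1))).add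
    (contDiff_const.mul (h1.norm_sq ℝ))).sub (contDiff_const.mul h2)

theorem hasFDerivAt_ballFun (κ : ℝ) (x₀ ν x : Euc n) :
    HasFDerivAt (ballFun κ x₀ ν) (innerSL ℝ (ballGrad κ x₀ ν x)) x := by
  have h1 : HasFDerivAt (fun x : Euc n => x - x₀) (ContinuousLinearMap.id ℝ (Euc n)) x :=
    (hasFDerivAt_id x).sub_const x₀
  have h2 := ((hasFDerivAt_const ν x).inner ℝ h1).sub (h1.norm_sq.const_mul κ)
  refine h2.congr_fderiv ?_
  ext e
  simp [ballGrad]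
  ring

theorem hasFDerivAt_testFun (k η ε κ α : ℝ) (xhat ν x₀ P : Euc n) (A : Euc n →L[ℝ] Euc n)
    (x : Euc n) :
    HasFDerivAt (testFun k η ε κ α xhat ν x₀ P A)
      (innerSL ℝ (testGrad η ε κ α xhat ν x₀ P A x)) x := by
  have h1 : HasFDerivAt (fun x : Euc n => x - x₀) (ContinuousLinearMap.id ℝ (Euc n)) x :=
    (hasFDerivAt_id x).sub_const x₀
  have hq := hasFDerivAt_ballFun κ xhat ν x
  have h2 := (((((hasFDerivAt_const P x).inner ℝ h1).const_add k).add
    (((A.hasFDerivAt.comp x h1).inner ℝ h1).const_mul (1 / 2))).add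
    (h1.norm_sq.const_mul η)).sub ((hq.add ((hq.pow 2).const_mul (α / 2))).const_mul ε)
  refine h2.congr_fderiv ?_
  ext e
  simp [testGrad, inner_sub_left, ContinuousLinearMap.adjoint_inner_left,
    real_inner_comm]
  ring

theorem hasGradientAt_testFun (k η ε κ α : ℝ) (xhat ν x₀ P : Euc n) (A : Euc n →L[ℝ] Euc n)
    (x : Euc n) :
    HasGradientAt (testFun k η ε κ α xhat ν x₀ P A)
      (testGrad η ε κ α xhat ν x₀ P A x) x :=
  hasGradientAt_iff_hasFDerivAt.mpr (hasFDerivAt_testFun k η ε κ α xhat ν x₀ P A x)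

/-- `A` is not assumed symmetric, so only its symmetric part enters the Hessian. -/
theorem hasFDerivAt_testGrad (η ε κ α : ℝ) (xhat ν x₀ P : Euc n) (A : Euc n →L[ℝ] Euc n)
    (x : Euc n) :
    HasFDerivAt (testGrad η ε κ α xhat ν x₀ P A)
      ((1 / 2 : ℝ) • (A + A.adjoint) + (2 * η) • ContinuousLinearMap.id ℝ (Euc n)
        - ((ε * α) • (innerSL ℝ (ballGrad κ xhat ν x)).smulRight (ballGrad κ xhat ν x)
          - (2 * κ * (ε * (1 + α * ballFun κ xhat ν x))) •
            ContinuousLinearMap.id ℝ (Euc n))) x := by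
  have h1 : ∀ y : Euc n,
      HasFDerivAt (fun x : Euc n => x - y) (ContinuousLinearMap.id ℝ (Euc n)) x :=
    fun y => (hasFDerivAt_id x).sub_const y
  have hq := hasFDerivAt_ballFun κ xhat ν x
  have hg : HasFDerivAt (ballGrad κ xhat ν) (-((2 * κ) • ContinuousLinearMap.id ℝ (Euc n))) x :=
    ((h1 xhat).const_smul (2 * κ)).const_sub ν
  have h2 := (((((A.hasFDerivAt.comp x (h1 x₀)).add
    (A.adjoint.hasFDerivAt.comp x (h1 x₀))).const_smul (1 / 2 : ℝ)).const_add P).add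
    ((h1 x₀).const_smul (2 * η))).sub ((((hq.const_mul α).const_add 1).const_mul ε).smul hg)
  refine h2.congr_fderiv ?_
  ext e
  simp
  ring

theorem hessianMatrix_apply {φ : Euc n → ℝ} {g : Euc n → Euc n} {M : Euc n →L[ℝ] Euc n}
    {x : Euc n} (hφ : ∀ y, HasGradientAt φ (g y) y) (hg : HasFDerivAt g M x) (i j : Fin n) :
    hessianMatrix φ x i j = M (EuclideanSpace.single i 1) j := by
  have h1 : fderiv ℝ φ = fun y => innerSL ℝ (g y) := by
    ext1 y
    exact (hφ y).hasFDerivAt.fderiv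
  have h2 : HasFDerivAt (fun y => innerSL ℝ (g y)) ((innerSL ℝ).comp M) x :=
    (innerSL ℝ).hasFDerivAt.comp x hg
  simp only [hessianMatrix, Matrix.of_apply]
  rw [h1, h2.fderiv]
  simp [EuclideanSpace.inner_single_right]

/-- The difference of the operator on two test functions with the same quadratic part. -/
theorem opF_testFun_eq (L : Euc n × Euc n → symMat n) (k k' η ε κ α : ℝ)
    (xhat ν x₀ y₀ P p : Euc n) (A : Euc n →L[ℝ] Euc n)
    (hφ : ContDiffAt ℝ 2 (testFun k η ε κ α xhat ν x₀ P A) x₀)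
    (hψ : ContDiffAt ℝ 2 (testFun k' (-η) 0 κ α xhat ν y₀ (P - p) A) y₀) :
    opF L (testFun k' (-η) 0 κ α xhat ν y₀ (P - p) A) y₀ hψ =
      opF L (testFun k η ε κ α xhat ν x₀ P A) x₀ hφ +
        ((ε * α) • tensorSq (ballGrad κ xhat ν x₀)
          - (4 * η + 2 * κ * (ε * (1 + α * ballFun κ xhat ν x₀))) • symOne n
          + (L (y₀, P - p)
            - L (x₀, P - (ε * (1 + α * ballFun κ xhat ν x₀)) • ballGrad κ xhat ν x₀))) := by
  have hg1 : gradient (testFun k η ε κ α xhat ν x₀ P A) x₀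
      = P - (ε * (1 + α * ballFun κ xhat ν x₀)) • ballGrad κ xhat ν x₀ := by
    rw [(hasGradientAt_testFun k η ε κ α xhat ν x₀ P A x₀).gradient]
    simp [testGrad]
  have hg2 : gradient (testFun k' (-η) 0 κ α xhat ν y₀ (P - p) A) y₀ = P - p := by
    rw [(hasGradientAt_testFun k' (-η) 0 κ α xhat ν y₀ (P - p) A y₀).gradient]
    simp [testGrad]
  have hH : (⟨_, hessianMatrix_mem hψ⟩ : symMat n) = ⟨_, hessianMatrix_mem hφ⟩ +
      ((ε * α) • tensorSq (ballGrad κ xhat ν x₀)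
          - (4 * η + 2 * κ * (ε * (1 + α * ballFun κ xhat ν x₀))) • symOne n) := by
    apply Subtype.ext
    ext i j
    simp only [Submodule.coe_add, Submodule.coe_sub, Submodule.coe_smul, Matrix.add_apply,
      Matrix.sub_apply, Matrix.smul_apply]
    rw [hessianMatrix_apply (hasGradientAt_testFun k η ε κ α xhat ν x₀ P A)
      (hasFDerivAt_testGrad η ε κ α xhat ν x₀ P A x₀),
      hessianMatrix_apply (hasGradientAt_testFun k' (-η) 0 κ α xhat ν y₀ (P - p) A)
      (hasFDerivAt_testGrad (-η) 0 κ α xhat ν y₀ (P - p) A y₀)]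
    have hone : (EuclideanSpace.single i (1 : ℝ) : Euc n) j = (symOne n : Matrix _ _ ℝ) i j := by
      simp [symOne, Matrix.one_apply, eq_comm]
    have htens : (tensorSq (ballGrad κ xhat ν x₀) : Matrix _ _ ℝ) i j
        = ballGrad κ xhat ν x₀ i * ballGrad κ xhat ν x₀ j := rfl
    rw [← hone, htens]
    simp [EuclideanSpace.inner_single_right]
    split_ifs <;> ring
  unfold opF
  rw [hg1, hg2, hH]
  abel

/-- A differentiable function touching a Lipschitz function from above has gradient bounded by
the Lipschitz constant. -/
theorem norm_gradient_le_of_touching {E : Type*} [NormedAddCommGroup E] [InnerProductSpace ℝ E]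
    [CompleteSpace E] {f φ : E → ℝ} {D : Set E} {K : NNReal} {x₀ g : E}
    (hf : LipschitzOnWith K f D) (hD : D ∈ 𝓝 x₀) (hφ : HasGradientAt φ g x₀)
    (heq : φ x₀ = f x₀) (hle : ∀ᶠ x in 𝓝 x₀, f x ≤ φ x) : ‖g‖ ≤ K := by
  refine le_of_forall_pos_le_add fun η hη => ?_
  rcases eq_or_ne g 0 with h0 | h0
  · rw [h0, norm_zero]; positivity
  have hgpos : 0 < ‖g‖ := norm_pos_iff.mpr h0
  have h1 := (hasGradientAt_iff_isLittleO.mp hφ).def hη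
  have h2 : ∀ᶠ x in 𝓝 x₀, ⟪g, x₀ - x⟫ ≤ (K + η) * ‖x - x₀‖ := by
    filter_upwards [h1, hle, hD] with x hx1 hx2 hx3
    have h3 := hf.dist_le_mul x hx3 x₀ (mem_of_mem_nhds hD)
    rw [Real.dist_eq, dist_eq_norm] at h3
    rw [Real.norm_eq_abs] at hx1
    have h4 := (abs_le.mp h3).1
    have h5 := (abs_le.mp hx1).2
    have h6 : ⟪g, x₀ - x⟫ = -⟪g, x - x₀⟫ := by rw [← inner_neg_right, neg_sub]
    rw [h6]
    linarith
  have htend : Tendsto (fun t : ℝ => x₀ - t • g) (𝓝[>] 0) (𝓝 x₀) := by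
    have : ContinuousAt (fun t : ℝ => x₀ - t • g) 0 := by fun_prop
    have h := this.tendsto
    simp only [zero_smul, sub_zero] at h
    exact h.mono_left nhdsWithin_le_nhds
  obtain ⟨t, ht, htpos⟩ := ((htend.eventually h2).and self_mem_nhdsWithin).exists
  have htpos : 0 < t := htpos
  rw [sub_sub_cancel, sub_sub_cancel_left, norm_neg, inner_smul_right,
    real_inner_self_eq_norm_sq, norm_smul, Real.norm_of_nonneg htpos.le] at ht
  have h3 : (t * ‖g‖) * ‖g‖ ≤ (t * ‖g‖) * (K + η) := by linarith
  exact le_of_mul_le_mul_left h3 (by positivity)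

/-- The bound `‖A‖ < μ` is strict: replacing `M` by a nearby `M'` in `U` changes `A` by `t⁻¹ • (M -
M')`, which the slack `μ - ‖A‖` absorbs. -/
theorem closure_add_coneAbout_mem {U : Set (symMat n)} {ν : Euc n} {μ : ℝ}
    (hU : ∀ M ∈ U, ∀ B ∈ coneAbout μ ν, M + B ∈ U) {M : symMat n} (hM : M ∈ closure U)
    {B : symMat n} (hB : B ∈ coneAbout μ ν) : M + B ∈ U := by
  obtain ⟨t, ht, A, hA, rfl⟩ := hB
  obtain ⟨M', hM', hdist⟩ := Metric.mem_closure_iff.mp hM (t * (μ - ‖A‖))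
    (mul_pos ht (by linarith))
  have h1 : M + t • (tensorSq ν + A) = M' + t • (tensorSq ν + (A + t⁻¹ • (M - M'))) := by
    rw [smul_add, smul_add, smul_add, smul_inv_smul₀ ht.ne']
    abel
  rw [h1]
  refine hU M' hM' _ ⟨t, ht, _, ?_, rfl⟩
  rw [dist_eq_norm] at hdist
  calc ‖A + t⁻¹ • (M - M')‖ ≤ ‖A‖ + t⁻¹ * ‖M - M'‖ := by
        refine (norm_add_le _ _).trans ?_
        rw [norm_smul, Real.norm_of_nonneg (by positivity)]
    _ < ‖A‖ + t⁻¹ * (t * (μ - ‖A‖)) := by gcongr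
    _ = μ := by field_simp; ring

end TestFunctions

/-! ### Comparison with the barrier. -/

section Comparison

open scoped RealInnerProductSpace

variable {n : ℕ}

/-- At a maximum point of the doubled functional the three points are close together and the
value of the difference is nearly maximal. -/
theorem doubling_estimates {E : Type*} [NormedAddCommGroup E] [InnerProductSpace ℝ E]
    {D : Set E} {a b : E → ℝ} {K : NNReal} (hb : LipschitzOnWith K b D) {c r : ℝ} (hc : 0 < c)
    {x₀ y₀ z₀ p x : E} (hx₀ : x₀ ∈ D) (hy₀ : y₀ ∈ D) (hx : x ∈ D) (hp : ‖p‖ ≤ r)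
    (hmax : ∀ x ∈ D, ∀ y ∈ D, ∀ z, a x - b y - c * ‖x - z‖ ^ 2 - c * ‖y - z‖ ^ 2 - ⟪p, z⟫ ≤
      a x₀ - b y₀ - c * ‖x₀ - z₀‖ ^ 2 - c * ‖y₀ - z₀‖ ^ 2 - ⟪p, z₀⟫) :
    ‖x₀ - z₀‖ + ‖y₀ - z₀‖ ≤ 2 * (K + r) / c ∧
      a x - b x - r * (‖x₀ - x‖ + (‖x₀ - z₀‖ + ‖y₀ - z₀‖)) ≤ a x₀ - b y₀ := by
  have hr : 0 ≤ r := (norm_nonneg p).trans hp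
  set X := ‖x₀ - z₀‖ with hX
  set Y := ‖y₀ - z₀‖ with hY
  have hX0 : 0 ≤ X := norm_nonneg _
  have hY0 : 0 ≤ Y := norm_nonneg _
  have hK : (0 : ℝ) ≤ K := K.2
  constructor
  -- Compare with the triple `(x₀, x₀, x₀)`: the penalty is quadratic in the distances, the gain
  -- only linear.
  · have h1 := hmax x₀ hx₀ x₀ hx₀ x₀
    have h2 := hb.dist_le_mul x₀ hx₀ y₀ hy₀
    rw [Real.dist_eq, dist_eq_norm] at h2
    have h3 : ‖x₀ - y₀‖ ≤ X + Y := by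
      rw [hY, norm_sub_rev y₀]
      exact norm_sub_le_norm_sub_add_norm_sub _ _ _
    have h4 : ⟪p, x₀⟫ - ⟪p, z₀⟫ ≤ r * X := by
      rw [← inner_sub_right]
      exact (real_inner_le_norm _ _).trans (by gcongr)
    have h5 := (abs_le.mp h2).2
    have h6 : (K : ℝ) * ‖x₀ - y₀‖ ≤ K * (X + Y) := by gcongr
    simp only [sub_self, norm_zero] at h1
    rw [le_div_iff₀ hc]
    have h7 : c * (X ^ 2 + Y ^ 2) ≤ (K + r) * (X + Y) := by nlinarith
    rcases eq_or_lt_of_le (add_nonneg hX0 hY0) with h0 | h0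
    · rw [← h0]; nlinarith
    · have h8 : (X + Y) * ((X + Y) * c) ≤ (X + Y) * (2 * (K + r)) := by
        nlinarith [mul_nonneg hc.le (sq_nonneg (X - Y))]
      exact le_of_mul_le_mul_left h8 h0
  · have h1 := hmax x hx x hx x
    simp only [sub_self, norm_zero] at h1
    have h2 : ⟪p, x⟫ - ⟪p, z₀⟫ ≤ r * (‖x₀ - x‖ + (X + Y)) := by
      rw [← inner_sub_right]
      refine (real_inner_le_norm _ _).trans ?_
      have : ‖x - z₀‖ ≤ ‖x₀ - x‖ + X := by
        rw [norm_sub_rev x₀]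
        exact norm_sub_le_norm_sub_add_norm_sub _ _ _
      gcongr
      linarith
    have h3 : 0 ≤ c * X ^ 2 := by positivity
    have h4 : 0 ≤ c * Y ^ 2 := by positivity
    linarith

/-- Comparison of a viscosity supersolution `u` with `v + ε h`, where `v` is a viscosity
subsolution and `h` is the barrier. -/
theorem comparison_barrier {Ω D V : Set (Euc n)} {U : Set (symMat n)}
    {L : Euc n × Euc n → symMat n} {u v : Euc n → ℝ} {xhat ν : Euc n} {κ α ε μ : ℝ}
    {K Λ : NNReal} (hUν : ∀ M ∈ U, ∀ B ∈ coneAbout μ ν, M + B ∈ U)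
    (hFu : ViscosityNotMem Ω L U u) (hFv : ViscosityMemClosure Ω L U v)
    (hD : IsCompact D) (hVo : IsOpen V) (hVD : V ⊆ D) (hVΩ : V ⊆ Ω)
    (hu : LipschitzOnWith K u D) (hv : LipschitzOnWith K v D)
    (hL : LipschitzOnWith Λ L (D ×ˢ Metric.closedBall 0 K))
    (hκ : 0 ≤ κ) (hα : 0 < α) (hε : 0 < ε) (hμ : 0 < μ)
    (hbd : ∀ x ∈ D, x ∉ V → v x + ε * barrier κ α xhat ν x ≤ u x)
    (hsmall : ∀ x ∈ V, ‖tensorSq (ballGrad κ xhat ν x) - tensorSq ν‖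
      + 2 * κ * |1 + α * ballFun κ xhat ν x| / α * ‖symOne n‖
      + Λ / α * (|1 + α * ballFun κ xhat ν x| * ‖ballGrad κ xhat ν x‖) ≤ μ / 2) :
    ∀ x ∈ D, v x + ε * barrier κ α xhat ν x ≤ u x := by
  by_contra! hcon
  obtain ⟨x₁, hx₁, hlt⟩ := hcon
  set a : Euc n → ℝ := fun x => v x + ε * barrier κ α xhat ν x with ha
  have hbarr : ContDiff ℝ 1 (fun x => ε * barrier κ α xhat ν x) :=
    contDiff_const.mul (contDiff_barrier κ α xhat ν)
  obtain ⟨K₁, hK₁⟩ := (hbarr.locallyLipschitz.locallyLipschitzOn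
    (s := D)).exists_lipschitzOnWith_of_compact hD
  have haL : LipschitzOnWith (K + K₁) a D := hv.add hK₁
  have huL : LipschitzOnWith (K + K₁) u D := hu.weaken (by simp)
  set Q : ℝ := ((K + K₁ : NNReal) : ℝ) with hQ
  have hQ0 : 0 ≤ Q := NNReal.coe_nonneg _
  set θ := a x₁ - u x₁ with hθ
  have hθ0 : 0 < θ := by simp only [hθ]; linarith
  set d := Metric.diam D with hd
  have hd0 : 0 ≤ d := Metric.diam_nonneg
  -- One parameter `τ` serves as `r`, `η` and `1 / c`. The bound `τ R < θ` keeps `x₀` and `y₀`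
  -- inside `V`; `τ R'` collects the doubling errors, divided by `εα`.
  set R := d + 2 * (Q + 1) + Q * (2 * (Q + 1)) with hR
  have hR0 : 0 < R := by positivity
  set R' := 4 / (ε * α) * ‖symOne n‖ + Λ / (ε * α) * (2 * (Q + 1) + 1) with hR'
  have hR'0 : 0 ≤ R' := by positivity
  obtain ⟨τ, hτ0, hτ1, hτR, hτR'⟩ :
      ∃ τ : ℝ, 0 < τ ∧ τ ≤ 1 ∧ τ * R < θ ∧ τ * R' < μ / 2 := by
    have h1 : Tendsto (fun τ : ℝ => τ * R) (𝓝[>] 0) (𝓝 0) := by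
      have : ContinuousAt (fun τ : ℝ => τ * R) 0 := by fun_prop
      simpa using this.tendsto.mono_left (nhdsWithin_le_nhds (s := Ioi 0))
    have h2 : Tendsto (fun τ : ℝ => τ * R') (𝓝[>] 0) (𝓝 0) := by
      have : ContinuousAt (fun τ : ℝ => τ * R') 0 := by fun_prop
      simpa using this.tendsto.mono_left (nhdsWithin_le_nhds (s := Ioi 0))
    obtain ⟨τ, ⟨⟨h3, h4⟩, h5⟩, h6⟩ := (((h1.eventually (gt_mem_nhds hθ0)).and
      (h2.eventually (gt_mem_nhds (half_pos hμ)))).and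
      ((eventually_le_nhds one_pos).filter_mono nhdsWithin_le_nhds)).and
      self_mem_nhdsWithin |>.exists
    exact ⟨τ, h6, h5, h3, h4⟩
  obtain ⟨x₀, y₀, z₀, p, P, A, hx₀, hy₀, hp, hmax, htouch⟩ :=
    exists_doubling_point hD ⟨x₁, hx₁⟩ haL.continuousOn huL.continuousOn
      (one_div_pos.mpr hτ0) hτ0
  obtain ⟨hs, hval⟩ := doubling_estimates huL (one_div_pos.mpr hτ0) hx₀ hy₀ hx₁ hp hmax
  obtain ⟨htx, hty⟩ := htouch τ hτ0
  set s := ‖x₀ - z₀‖ + ‖y₀ - z₀‖ with hsdef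
  have hs' : s ≤ τ * (2 * (Q + 1)) := by
    refine hs.trans ?_
    rw [div_div_eq_mul_div, div_one, ← hQ, mul_comm τ]
    gcongr
  have hxy : ‖x₀ - y₀‖ ≤ s := by
    rw [hsdef, norm_sub_rev y₀]
    exact norm_sub_le_norm_sub_add_norm_sub _ _ _
  have hxx : ‖x₀ - x₁‖ ≤ d := by
    rw [← dist_eq_norm]
    exact Metric.dist_le_diam_of_mem hD.isBounded hx₀ hx₁
  have hQs : Q * ‖x₀ - y₀‖ ≤ τ * (Q * (2 * (Q + 1))) :=
    calc _ ≤ Q * (τ * (2 * (Q + 1))) := by gcongr; exact hxy.trans hs'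
      _ = _ := by ring
  -- The gap exceeds what the Lipschitz bounds permit if either point lay where `a ≤ u`.
  have hgap : Q * ‖x₀ - y₀‖ < a x₀ - u y₀ := by
    have h1 : τ * (‖x₀ - x₁‖ + s) ≤ τ * (d + 2 * (Q + 1)) := by
      gcongr
      refine hs'.trans ?_
      nlinarith
    have h2 : τ * R = τ * (d + 2 * (Q + 1)) + τ * (Q * (2 * (Q + 1))) := by rw [hR]; ring
    linarith
  have hx₀V : x₀ ∈ V := by
    by_contra h
    have h1 := hbd x₀ hx₀ h
    have h2 := huL.dist_le_mul x₀ hx₀ y₀ hy₀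
    rw [Real.dist_eq, dist_eq_norm] at h2
    have h3 := (abs_le.mp h2).2
    simp only [ha] at hgap
    linarith
  have hy₀V : y₀ ∈ V := by
    by_contra h
    have h1 := hbd y₀ hy₀ h
    have h2 := haL.dist_le_mul x₀ hx₀ y₀ hy₀
    rw [Real.dist_eq, dist_eq_norm] at h2
    have h3 := (abs_le.mp h2).2
    simp only [ha] at hgap h3
    linarith
  have hDx : D ∈ 𝓝 x₀ := mem_of_superset (hVo.mem_nhds hx₀V) hVD
  have hDy : D ∈ 𝓝 y₀ := mem_of_superset (hVo.mem_nhds hy₀V) hVD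
  set φ := testFun (a x₀) τ ε κ α xhat ν x₀ P A with hφ
  set ψ := testFun (u y₀) (-τ) 0 κ α xhat ν y₀ (P - p) A with hψ
  have hφ2 : ContDiff ℝ 2 φ := contDiff_testFun _ _ _ _ _ _ _ _ _ _
  have hψ2 : ContDiff ℝ 2 ψ := contDiff_testFun _ _ _ _ _ _ _ _ _ _
  have hφ0 : φ x₀ = v x₀ := by simp [hφ, testFun, ha]
  have hψ0 : ψ y₀ = u y₀ := by simp [hψ, testFun]
  have hφle : ∀ᶠ x in 𝓝 x₀, v x ≤ φ x := by
    filter_upwards [htx, hDx] with x hx hxD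
    have := hx hxD
    simp only [hφ, testFun]
    simp only [ha] at this ⊢
    linarith
  have hψle : ∀ᶠ y in 𝓝 y₀, ψ y ≤ u y := by
    filter_upwards [hty, hDy] with y hy hyD
    have := hy hyD
    simp only [hψ, testFun]
    linarith
  have hX := hFv x₀ (hVΩ hx₀V) φ hφ2.contDiffOn hφ2.contDiffAt hφ0 hφle
  have hY := hFu y₀ (hVΩ hy₀V) ψ hψ2.contDiffOn hψ2.contDiffAt hψ0 hψle
  set m := 1 + α * ballFun κ xhat ν x₀ with hm
  set g := ballGrad κ xhat ν x₀ with hg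
  -- Both test gradients stay in the ball of radius `K`, whatever `ε` and `τ`, so the Lipschitz
  -- constant `Λ` of `L` applies.
  have hgx : ‖P - (ε * m) • g‖ ≤ K := by
    have h1 := hasGradientAt_testFun (a x₀) τ ε κ α xhat ν x₀ P A x₀
    have h2 : testGrad τ ε κ α xhat ν x₀ P A x₀ = P - (ε * m) • g := by simp [testGrad, hm, hg]
    rw [h2] at h1
    exact norm_gradient_le_of_touching hv hDx h1 hφ0 hφle
  have hgy : ‖P - p‖ ≤ K := by
    have h1 := hasGradientAt_testFun (u y₀) (-τ) 0 κ α xhat ν y₀ (P - p) A y₀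
    have h2 : testGrad (-τ) 0 κ α xhat ν y₀ (P - p) A y₀ = P - p := by simp [testGrad]
    rw [h2] at h1
    have h3 : HasGradientAt (fun y => -ψ y) (-(P - p)) y₀ := by
      rw [hasGradientAt_iff_hasFDerivAt, map_neg]
      exact h1.hasFDerivAt.neg
    have h4 : LipschitzOnWith K (fun y => -u y) D := hu.neg
    rw [← norm_neg]
    exact norm_gradient_le_of_touching h4 hDy h3 (by rw [hψ0])
      (hψle.mono fun y hy => neg_le_neg hy)
  have hLd : ‖L (y₀, P - p) - L (x₀, P - (ε * m) • g)‖
      ≤ Λ * (τ * (2 * (Q + 1) + 1) + ε * (|m| * ‖g‖)) := by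
    have h1 := hL.dist_le_mul (y₀, P - p) ⟨hy₀, by simpa using hgy⟩
      (x₀, P - (ε * m) • g) ⟨hx₀, by simpa using hgx⟩
    rw [dist_eq_norm] at h1
    refine h1.trans ?_
    gcongr
    rw [Prod.dist_eq, dist_eq_norm, dist_eq_norm]
    refine max_le ?_ ?_
    · rw [norm_sub_rev]
      have h2 : 0 ≤ ε * (|m| * ‖g‖) := by positivity
      linarith
    · have h2 : P - p - (P - (ε * m) • g) = (ε * m) • g - p := by abel
      simp only
      rw [h2]
      refine (norm_sub_le _ _).trans ?_
      rw [norm_smul, Real.norm_eq_abs, abs_mul, abs_of_pos hε]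
      have h3 : 0 ≤ τ * (2 * (Q + 1)) := by positivity
      linarith
  -- The second order parts cancel, so `F[ψ]` is `F[φ]`, an element of `closure U`, plus a matrix in
  -- the open cone; hence it lies in `U`, a contradiction.
  refine hY ?_
  rw [opF_testFun_eq L (a x₀) (u y₀) τ ε κ α xhat ν x₀ y₀ P p A hφ2.contDiffAt]
  refine closure_add_coneAbout_mem hUν hX ?_
  have hεα : 0 < ε * α := by positivity
  set ΔL := L (y₀, P - p) - L (x₀, P - (ε * m) • g) with hΔL
  refine ⟨ε * α, hεα, (tensorSq g - tensorSq ν)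
    - ((4 * τ + 2 * κ * (ε * m)) / (ε * α)) • symOne n + (ε * α)⁻¹ • ΔL, ?_, ?_⟩
  · have h1 : ‖((4 * τ + 2 * κ * (ε * m)) / (ε * α)) • symOne n‖
        ≤ (4 * τ / (ε * α) + 2 * κ * |m| / α) * ‖symOne n‖ := by
      rw [norm_smul]
      gcongr
      rw [Real.norm_eq_abs, add_div]
      refine (abs_add_le _ _).trans ?_
      rw [abs_of_nonneg (by positivity : 0 ≤ 4 * τ / (ε * α))]
      gcongr
      have : 2 * κ * (ε * m) / (ε * α) = 2 * κ / α * m := by field_simp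
      rw [this, abs_mul, abs_of_nonneg (by positivity)]
      apply le_of_eq; ring
    have h2 : ‖(ε * α)⁻¹ • ΔL‖
        ≤ (ε * α)⁻¹ * (Λ * (τ * (2 * (Q + 1) + 1) + ε * (|m| * ‖g‖))) := by
      rw [norm_smul, Real.norm_of_nonneg (by positivity)]
      gcongr
    have h3 := hsmall x₀ hx₀V
    rw [← hm, ← hg] at h3
    have h4 : (4 * τ / (ε * α) + 2 * κ * |m| / α) * ‖symOne n‖
        + (ε * α)⁻¹ * (Λ * (τ * (2 * (Q + 1) + 1) + ε * (|m| * ‖g‖)))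
        = τ * R' + (2 * κ * |m| / α * ‖symOne n‖ + Λ / α * (|m| * ‖g‖)) := by
      rw [hR']; field_simp; ring
    calc _ ≤ ‖tensorSq g - tensorSq ν‖ + ‖((4 * τ + 2 * κ * (ε * m)) / (ε * α)) • symOne n‖
          + ‖(ε * α)⁻¹ • ΔL‖ :=
          (norm_add_le _ _).trans (by gcongr; exact norm_sub_le _ _)
      _ < μ := by linarith
  · rw [smul_add, smul_add, smul_sub, smul_sub, smul_smul, smul_inv_smul₀ hεα.ne',
      mul_div_cancel₀ _ hεα.ne']
    abel

end Comparison

/-! ### Interior ball, choice of constants and the Hopf lemma. -/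

section Hopf

open scoped RealInnerProductSpace

/-- A `C²` function is bounded below by its first order expansion up to a quadratic error. -/
theorem ContDiffAt.exists_quadratic_lower_bound {E : Type*} [NormedAddCommGroup E]
    [NormedSpace ℝ E] {ρ : E → ℝ} {x₀ : E} (hρ : ContDiffAt ℝ 2 ρ x₀) :
    ∃ C ≥ 0, ∃ δ > 0, ∀ x, ‖x - x₀‖ < δ →
      ρ x₀ + fderiv ℝ ρ x₀ (x - x₀) - C * ‖x - x₀‖ ^ 2 ≤ ρ x := by
  have h1 : ContDiffAt ℝ 1 (fderiv ℝ ρ) x₀ := hρ.fderiv_right (by norm_num)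
  obtain ⟨C, t, ht, hLip⟩ := h1.exists_lipschitzOnWith
  have h2 : ∀ᶠ x in 𝓝 x₀, DifferentiableAt ℝ ρ x :=
    (hρ.eventually (by simp)).mono fun x hx => hx.differentiableAt (by simp)
  obtain ⟨δ, hδ, hball⟩ := Metric.eventually_nhds_iff_ball.mp (h2.and ht)
  refine ⟨C, C.2, δ, hδ, fun x hx => ?_⟩
  have hsub : ∀ y ∈ Metric.closedBall x₀ ‖x - x₀‖, y ∈ Metric.ball x₀ δ := fun y hy =>
    Metric.mem_ball.mpr ((Metric.mem_closedBall.mp hy).trans_lt hx)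
  have h3 : ∀ y ∈ Metric.closedBall x₀ ‖x - x₀‖,
      ‖fderiv ℝ ρ y - fderiv ℝ ρ x₀‖ ≤ C * ‖x - x₀‖ := fun y hy => by
    rw [← dist_eq_norm]
    refine (hLip.dist_le_mul y (hball y (hsub y hy)).2 x₀ (mem_of_mem_nhds ht)).trans ?_
    gcongr
    exact Metric.mem_closedBall.mp hy
  have h4 := (convex_closedBall x₀ ‖x - x₀‖).norm_image_sub_le_of_norm_hasFDerivWithin_le'
    (fun y hy => (hball y (hsub y hy)).1.hasFDerivAt.hasFDerivWithinAt) h3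
    (Metric.mem_closedBall_self (norm_nonneg _))
    (by rw [Metric.mem_closedBall, dist_eq_norm] : x ∈ Metric.closedBall x₀ ‖x - x₀‖)
  rw [Real.norm_eq_abs] at h4
  have h5 := (abs_le.mp h4).1
  nlinarith

variable {n : ℕ}

/-- The interior sphere condition at a point where the boundary is `C²`. -/
theorem IsC2BoundaryWithInteriorNormal.interior_ball {Ω : Set (Euc n)} {xhat ν : Euc n}
    (h : IsC2BoundaryWithInteriorNormal Ω xhat ν) :
    ‖ν‖ = 1 ∧ ∃ κ > 0, {x | 0 ≤ ballFun κ xhat ν x} ⊆ Ω ∪ {xhat} := by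
  obtain ⟨hfr, N, ρ, hNo, hxN, hρ, hgrad, hΩN, hfrN, hν⟩ := h
  set G := ‖gradient ρ xhat‖ with hG
  have hGpos : 0 < G := norm_pos_iff.mpr (hgrad xhat hxN)
  have hν1 : ‖ν‖ = 1 := by
    rw [hν, norm_smul, norm_inv, norm_norm, inv_mul_cancel₀ hGpos.ne']
  have hρ0 : ρ xhat = 0 := by
    have : xhat ∈ frontier Ω ∩ N := ⟨hfr, hxN⟩
    rw [hfrN] at this
    exact this.2
  have hρC : ContDiffAt ℝ 2 ρ xhat := hρ.contDiffAt (hNo.mem_nhds hxN)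
  obtain ⟨C, hC, δ, hδ, hlow⟩ := hρC.exists_quadratic_lower_bound
  obtain ⟨δ', hδ', hball⟩ := Metric.mem_nhds_iff.mp (hNo.mem_nhds hxN)
  have hfd : ∀ e, fderiv ℝ ρ xhat e = G * ⟪ν, e⟫ := by
    intro e
    have h1 := (hρC.differentiableAt (by simp)).hasGradientAt.hasFDerivAt.fderiv
    rw [h1, hν, inner_smul_left, InnerProductSpace.toDual_apply_apply]
    simp only [conj_trivial]
    rw [mul_inv_cancel_left₀ hGpos.ne']
  -- The terms `1 / δ` and `1 / δ'` force the diameter `1 / κ` below both radii; `C / G` makes the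
  -- linear part of `ρ` beat its quadratic error.
  refine ⟨hν1, C / G + 1 / δ + 1 / δ' + 1, by positivity, fun x hx => ?_⟩
  set κ := C / G + 1 / δ + 1 / δ' + 1 with hκ
  have hκpos : 0 < κ := by positivity
  rcases eq_or_ne x xhat with rfl | hne
  · exact Or.inr rfl
  refine Or.inl ?_
  have hd : 0 < ‖x - xhat‖ := norm_pos_iff.mpr (sub_ne_zero.mpr hne)
  have hx' : κ * ‖x - xhat‖ ^ 2 ≤ ⟪ν, x - xhat⟫ := by
    have : 0 ≤ ballFun κ xhat ν x := hx
    unfold ballFun at this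
    linarith
  have hle : ⟪ν, x - xhat⟫ ≤ ‖x - xhat‖ := by
    have := real_inner_le_norm ν (x - xhat)
    rwa [hν1, one_mul] at this
  have hκd : κ * ‖x - xhat‖ ≤ 1 := by
    have : ‖x - xhat‖ * (κ * ‖x - xhat‖) ≤ ‖x - xhat‖ * 1 := by nlinarith
    exact le_of_mul_le_mul_left this hd
  have hsmall : ∀ η > 0, 1 / η < κ → ‖x - xhat‖ < η := by
    intro η hη h
    have h1 : 1 / η * ‖x - xhat‖ < 1 := (mul_lt_mul_of_pos_right h hd).trans_le hκd
    rw [one_div, inv_mul_lt_iff₀ hη] at h1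
    linarith
  have hCG : 0 ≤ C / G := by positivity
  have hδi : 0 < 1 / δ := by positivity
  have hδi' : 0 < 1 / δ' := by positivity
  have h1 := hlow x (hsmall δ hδ (by linarith))
  have h2 : x ∈ N := hball (by
    rw [mem_ball_iff_norm]
    exact hsmall δ' hδ' (by linarith))
  rw [hρ0, hfd] at h1
  have h3 : C < G * κ := by
    have : G * κ = C + G * (1 / δ + 1 / δ' + 1) := by rw [hκ]; field_simp; ring
    rw [this]
    have : 0 < G * (1 / δ + 1 / δ' + 1) := by positivity
    linarith
  have h4 : G * (κ * ‖x - xhat‖ ^ 2) ≤ G * ⟪ν, x - xhat⟫ := by gcongr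
  have h5 : C * ‖x - xhat‖ ^ 2 < G * κ * ‖x - xhat‖ ^ 2 := by gcongr
  have h6 : x ∈ {x | x ∈ N ∧ 0 < ρ x} := ⟨h2, by linarith⟩
  rw [← hΩN] at h6
  exact h6.1

theorem continuous_tensorSq : Continuous (tensorSq : Euc n → symMat n) := by
  refine Continuous.subtype_mk ?_ _
  refine continuous_matrix fun i j => ?_
  simp only [Matrix.of_apply]
  fun_prop

theorem exists_radius_tensorSq_sub_lt (κ : ℝ) (xhat ν : Euc n) {η : ℝ} (hη : 0 < η) :
    ∃ δ > 0, ∀ x, ‖x - xhat‖ < δ → ‖tensorSq (ballGrad κ xhat ν x) - tensorSq ν‖ < η := by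
  have h1 : Continuous fun x => ballGrad κ xhat ν x := by
    unfold ballGrad
    fun_prop
  have h2 := (continuous_tensorSq.comp h1).continuousAt (x := xhat)
  obtain ⟨δ, hδ, h⟩ := Metric.continuousAt_iff.mp h2 η hη
  refine ⟨δ, hδ, fun x hx => ?_⟩
  have := h (by rwa [dist_eq_norm] : dist x xhat < δ)
  rw [dist_eq_norm] at this
  simpa [ballGrad] using this

/-- A quantitative form of the Hopf lemma: the difference dominates a multiple of the barrier. -/
theorem exists_barrier_le {Ω : Set (Euc n)} {xhat ν : Euc n} {U : Set (symMat n)}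
    {L : Euc n × Euc n → symMat n} {u v : Euc n → ℝ} {κ : ℝ} (hUν : ConditionU U ν)
    (hL : LocallyLipschitzOn ((Ω ∪ {xhat}) ×ˢ (univ : Set (Euc n))) L)
    (hu : LocallyLipschitzOn (Ω ∪ {xhat}) u) (hv : LocallyLipschitzOn (Ω ∪ {xhat}) v)
    (hFu : ViscosityNotMem Ω L U u) (hFv : ViscosityMemClosure Ω L U v)
    (huv : ∀ x ∈ Ω, v x < u x) (heq : u xhat = v xhat) (hν : ‖ν‖ = 1) (hκ : 0 < κ)
    (hball : {x | 0 ≤ ballFun κ xhat ν x} ⊆ Ω ∪ {xhat}) :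
    ∃ δ > 0, ∃ ε > 0, ∃ α > 0, ∀ x, 0 ≤ ballFun κ xhat ν x → ‖x - xhat‖ ≤ δ →
      v x + ε * barrier κ α xhat ν x ≤ u x := by
  obtain ⟨μ, hμ, hUμ⟩ := hUν
  have hq : Continuous (ballFun κ xhat ν) := (contDiff_ballFun κ xhat ν (m := 0)).continuous
  have hle : ∀ x, ⟪ν, x - xhat⟫ ≤ ‖x - xhat‖ := fun x => by
    have := real_inner_le_norm ν (x - xhat)
    rwa [hν, one_mul] at this
  set B := {x | 0 ≤ ballFun κ xhat ν x} with hB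
  have hBclosed : IsClosed B := isClosed_le continuous_const hq
  have hBcomp : IsCompact B := by
    refine Metric.isCompact_of_isClosed_isBounded hBclosed ?_
    refine (Metric.isBounded_closedBall (x := xhat) (r := 1 / κ)).subset fun x hx => ?_
    rw [mem_closedBall_iff_norm]
    have h1 : 0 ≤ ballFun κ xhat ν x := hx
    unfold ballFun at h1
    have h2 := hle x
    rcases eq_or_lt_of_le (norm_nonneg (x - xhat)) with h0 | h0
    · rw [← h0]; positivity
    · rw [le_div_iff₀ hκ]
      have : ‖x - xhat‖ * (‖x - xhat‖ * κ) ≤ ‖x - xhat‖ * 1 := by nlinarith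
      exact le_of_mul_le_mul_left this h0
  -- The Lipschitz constants are taken on the whole ball, before `α`, `δ` and `ε`, which depend on
  -- them.
  obtain ⟨K₁, hK₁⟩ := (hu.mono hball).exists_lipschitzOnWith_of_compact hBcomp
  obtain ⟨K₂, hK₂⟩ := (hv.mono hball).exists_lipschitzOnWith_of_compact hBcomp
  set K := max K₁ K₂ with hK
  obtain ⟨Λ, hΛ⟩ := (hL.mono (prod_mono hball (subset_univ
    (Metric.closedBall (0 : Euc n) K)))).exists_lipschitzOnWith_of_compact
    (hBcomp.prod (isCompact_closedBall _ _))
  -- Chosen so that the errors from the identity matrix and from `L`, at most `4 (κ‖I‖ + Λ) / α`,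
  -- stay below `μ / 4`.
  set α := 16 * (κ * ‖symOne n‖ + Λ) / μ + 1 with hα
  have hαpos : 0 < α := by positivity
  obtain ⟨δ₁, hδ₁, htens⟩ := exists_radius_tensorSq_sub_lt κ xhat ν
    (by positivity : 0 < μ / 4)
  -- These bounds give, in turn, `∇q ⊗ ∇q` within `μ / 4` of `ν ⊗ ν`, `α q ≤ 1`, and `‖∇q‖ ≤ 2`.
  set δ := min δ₁ (min (1 / α) (1 / (2 * κ))) with hδ
  have hδpos : 0 < δ := by positivity
  have hδα : α * δ ≤ 1 := by
    have : δ ≤ 1 / α := (min_le_right _ _).trans (min_le_left _ _)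
    rw [le_div_iff₀ hαpos] at this
    linarith
  have hδκ : 2 * κ * δ ≤ 1 := by
    have : δ ≤ 1 / (2 * κ) := (min_le_right _ _).trans (min_le_right _ _)
    rw [le_div_iff₀ (by positivity)] at this
    linarith
  have hqδ : ∀ x, ‖x - xhat‖ ≤ δ → ballFun κ xhat ν x ≤ δ := fun x hx => by
    have h1 := hle x
    have h2 : 0 ≤ κ * ‖x - xhat‖ ^ 2 := by positivity
    unfold ballFun
    linarith
  set S := B ∩ Metric.sphere xhat δ with hS
  have hScomp : IsCompact S := hBcomp.inter_right Metric.isClosed_sphere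
  have hne : ∀ x ∈ B, x ≠ xhat → x ∈ Ω := fun x hx h => (hball hx).resolve_right h
  have hSΩ : S ⊆ Ω := fun x hx => hne x hx.1 (by
    rintro rfl
    have := hx.2
    simp only [mem_sphere_iff_norm, sub_self, norm_zero] at this
    exact hδpos.ne this)
  have hSB : S ⊆ Ω ∪ {xhat} := hSΩ.trans subset_union_left
  obtain ⟨m, hm, hmle⟩ := hScomp.exists_forall_le' (f := fun x => u x - v x)
    ((hu.continuousOn.mono hSB).sub (hv.continuousOn.mono hSB)) (a := 0)
    (fun x hx => sub_pos.mpr (huv x (hSΩ hx)))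
  -- On the outer part of the lens boundary the barrier is at most `2δ`, so this `ε` gives `ε h ≤ m
  -- ≤ u - v` there.
  have hεpos : 0 < m / (2 * δ) := by positivity
  refine ⟨δ, hδpos, m / (2 * δ), hεpos, α, hαpos, fun x hx hxδ => ?_⟩
  have hqcont : Continuous fun x : Euc n => ‖x - xhat‖ := by fun_prop
  refine comparison_barrier (D := B ∩ Metric.closedBall xhat δ)
    (V := {x | 0 < ballFun κ xhat ν x ∧ ‖x - xhat‖ < δ}) (Λ := Λ) (K := K) hUμ hFu hFv
    (hBcomp.inter_right Metric.isClosed_closedBall)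
    ((isOpen_lt continuous_const hq).inter (isOpen_lt hqcont continuous_const))
    (fun y hy => ⟨le_of_lt hy.1, mem_closedBall_iff_norm.mpr hy.2.le⟩)
    (fun y hy => hne y (le_of_lt hy.1) (by
      rintro rfl
      have := hy.1
      simp [ballFun] at this))
    ((hK₁.weaken (le_max_left _ _)).mono inter_subset_left)
    ((hK₂.weaken (le_max_right _ _)).mono inter_subset_left)
    (hΛ.mono (prod_mono inter_subset_left subset_rfl)) hκ.le hαpos hεpos hμ ?_ ?_ x
    ⟨hx, mem_closedBall_iff_norm.mpr hxδ⟩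
  · rintro y ⟨hyB, hyδ⟩ hyV
    rw [mem_closedBall_iff_norm] at hyδ
    have hy0 : 0 ≤ ballFun κ xhat ν y := hyB
    rcases eq_or_lt_of_le hy0 with h0 | h0
    · rw [barrier, ← h0]
      rcases hball hyB with h | h
      · simpa using (huv y h).le
      · rw [mem_singleton_iff] at h
        simp [h, heq]
    · have h1 : ‖y - xhat‖ = δ := le_antisymm hyδ (not_lt.mp fun h => hyV ⟨h0, h⟩)
      have h2 := hmle y ⟨hyB, mem_sphere_iff_norm.mpr h1⟩
      have h3 := hqδ y hyδ
      have h4 : barrier κ α xhat ν y ≤ 2 * δ := by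
        have h5 : α * ballFun κ xhat ν y ≤ 1 := (by gcongr : _ ≤ α * δ).trans hδα
        unfold barrier
        nlinarith
      have h6 : m / (2 * δ) * barrier κ α xhat ν y ≤ m / (2 * δ) * (2 * δ) := by gcongr
      rw [div_mul_cancel₀ _ (by positivity)] at h6
      linarith
  · rintro y ⟨hy0, hyδ⟩
    have h1 : |1 + α * ballFun κ xhat ν y| ≤ 2 := by
      have h5 : α * ballFun κ xhat ν y ≤ 1 :=
        (by gcongr; exact hqδ y hyδ.le : _ ≤ α * δ).trans hδα
      rw [abs_of_pos (by positivity)]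
      linarith
    have h2 : ‖ballGrad κ xhat ν y‖ ≤ 2 := by
      refine (norm_sub_le _ _).trans ?_
      rw [hν, norm_smul, Real.norm_of_nonneg (by positivity)]
      have : 2 * κ * ‖y - xhat‖ ≤ 2 * κ * δ := by gcongr
      linarith
    have h3 := htens y (hyδ.trans_le (min_le_left _ _))
    have h4 : 2 * κ * |1 + α * ballFun κ xhat ν y| / α * ‖symOne n‖
        + Λ / α * (|1 + α * ballFun κ xhat ν y| * ‖ballGrad κ xhat ν y‖)
        ≤ 2 * κ * 2 / α * ‖symOne n‖ + Λ / α * (2 * 2) := by gcongr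
    have h5 : 2 * κ * 2 / α * ‖symOne n‖ + Λ / α * (2 * 2)
        = 4 * (κ * ‖symOne n‖ + Λ) / α := by ring
    have h6 : 4 * (κ * ‖symOne n‖ + Λ) / α ≤ μ / 4 := by
      rw [div_le_iff₀ hαpos]
      have : μ / 4 * α = 4 * (κ * ‖symOne n‖ + Λ) + μ / 4 := by rw [hα]; field_simp; ring
      linarith
    linarith

end Hopf

theorem theorem1p3 (n : ℕ) (hn : 2 ≤ n) (Ω : Set (Euc n)) (hΩo : IsOpen Ω)
    (hΩc : IsConnected Ω) (xhat ν : Euc n) (hbdry : IsC2BoundaryWithInteriorNormal Ω xhat ν)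
    (U : Set (symMat n)) (hUo : IsOpen U) (hU : EllipticCone U) (hUν : ConditionU U ν)
    (L : Euc n × Euc n → symMat n)
    (hL : LocallyLipschitzOn ((Ω ∪ {xhat}) ×ˢ (univ : Set (Euc n))) L)
    (u v : Euc n → ℝ)
    (hu : LocallyLipschitzOn (Ω ∪ {xhat}) u) (hv : LocallyLipschitzOn (Ω ∪ {xhat}) v)
    (hFu : ViscosityNotMem Ω L U u) (hFv : ViscosityMemClosure Ω L U v)
    (huv : ∀ x ∈ Ω, v x < u x) (heq : u xhat = v xhat) :
    (0 : EReal) < liminf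
      (fun s : ℝ => (((u (xhat + s • ν) - v (xhat + s • ν)) / s : ℝ) : EReal))
      (𝓝[>] (0 : ℝ)) := by
  obtain ⟨hν, κ, hκ, hball⟩ := hbdry.interior_ball
  obtain ⟨δ, hδ, ε, hε, α, hα, hle⟩ :=
    exists_barrier_le hUν hL hu hv hFu hFv huv heq hν hκ hball
  have hlow : ∀ᶠ s : ℝ in 𝓝[>] (0 : ℝ), ((ε / 2 : ℝ) : EReal) ≤
      (((u (xhat + s • ν) - v (xhat + s • ν)) / s : ℝ) : EReal) := by
    filter_upwards [Ioo_mem_nhdsGT (lt_min hδ (by positivity : 0 < 1 / (2 * κ)))] with s hs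
    obtain ⟨hs0, hs1⟩ := hs
    have hsδ : s ≤ δ := hs1.le.trans (min_le_left _ _)
    have hsκ : κ * s ≤ 1 / 2 := by
      have : s ≤ 1 / (2 * κ) := hs1.le.trans (min_le_right _ _)
      rw [le_div_iff₀ (by positivity)] at this
      linarith
    have hnorm : ‖s • ν‖ = s := by rw [norm_smul, hν, mul_one, Real.norm_of_nonneg hs0.le]
    have hq : ballFun κ xhat ν (xhat + s • ν) = s - κ * s ^ 2 := by
      rw [ballFun, add_sub_cancel_left, hnorm, inner_smul_right, real_inner_self_eq_norm_sq, hν]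
      ring
    -- Along the normal `q = s - κ s²`, and `κ s ≤ 1 / 2`; this bounds the quotient below by `ε /
    -- 2`.
    have hq' : s / 2 ≤ ballFun κ xhat ν (xhat + s • ν) := by
      rw [hq]
      nlinarith
    have h1 := hle (xhat + s • ν) (by linarith) (by rw [add_sub_cancel_left, hnorm]; exact hsδ)
    have h2 : ballFun κ xhat ν (xhat + s • ν) ≤ barrier κ α xhat ν (xhat + s • ν) := by
      unfold barrier
      have : 0 ≤ α / 2 * ballFun κ xhat ν (xhat + s • ν) ^ 2 := by positivity
      linarith
    rw [EReal.coe_le_coe_iff, le_div_iff₀ hs0]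
    have h3 : ε * (s / 2) ≤ ε * barrier κ α xhat ν (xhat + s • ν) := by
      gcongr
      exact hq'.trans h2
    linarith
  refine lt_of_lt_of_le ?_ (le_liminf_of_le (by isBoundedDefault) hlow)
  exact_mod_cast half_pos hε
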